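/- **Core Remora.** Fix a set of base types $B$, a set of constants, each with a base type, and a set of primitive operators $\mathfrak o$, each with a closed, well-kinded function type $\tau^{\mathfrak o}_1\cdots\tau^{\mathfrak o}_m\to\tau^{\mathfrak o}_{\rm out}$ (a polymorphic primitive counts as a family of operators). Terms are taken up to renaming of bound variables. *Indices* $\iota$ are variables, naturals $n$, shapes $(\mathtt{shape}\ \iota\ldots)$, sums $(+\ \iota\ldots)$ and concatenations $(\mathbin{+\!+}\ \iota\ldots)$. Their sorts are $\mathtt{Dim}$ (naturals, and sums of dimensions) and $\mathtt{Shape}$ (sequences of dimensions, and concatenations of shapes). Two well-sorted shapes are equal in a sort environment $\Theta$ ($\iota\equiv_\Theta\iota'$) if they denote the same sequence of naturals for all values of their variables; $\iota\sqsubseteq\iota'$ means $(\mathbin{+\!+}\ \iota\ w)\equiv_\Theta\iota'$ for some $w$; and $\iota_p=\mathrm{Max}(\iota_1,\ldots)$ means that $\iota_p$ is one of the $\iota_j$ and $\iota_j\sqsubseteq\iota_p$ for all $j$. *Types* are type variables, base types, functions $(\tau\ldots)\to\tau'$, $\forall(x::k\ldots).\tau$, $\Pi(x::\gamma\ldots).\tau$,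 $\Sigma(x::\gamma\ldots).\tau$ and arrays $\mathtt{Arr}\,\tau\,\iota$. Kinds are $\mathtt{Atom}$ and $\mathtt{Array}$: $\mathtt{Arr}\,\tau\,\iota$ has kind $\mathtt{Array}$ if $\tau$ has kind $\mathtt{Atom}$ and $\iota$ has sort $\mathtt{Shape}$; base types have kind $\mathtt{Atom}$; function, $\forall$, $\Pi$ and $\Sigma$ types have kind $\mathtt{Atom}$ if their immediate component types have kind $\mathtt{Array}$; the kind of a type variable is given by the environment. Type equivalence $\cong$ is the reflexive congruence generated by equality of shapes. *Atoms* $\mathfrak a$ are constants, operators, $\lambda(x:\tau\ldots).e$, $\mathtt T\lambda(x::k\ldots).e$, $\mathtt I\lambda(x::\gamma\ldots).e$ and boxes $\mathtt{box}\ \iota\ldots\ e\ \tau$. *Expressions* are variables, array literals $(\mathtt{array}\ (n\ldots)\ \mathfrak a\ldots)$, frames $(\mathtt{frame}\ (n\ldots)\ e\ldots)$, term, type and index applications, and $\mathtt{unbox}\ (x\ldots\ y\ e)\ e'$, which binds the index variables $x\ldots$ and the term variable $y$ in $e'$. Every expression other than a variable is tagged with a type. *Values* are array literals all of whose atoms are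 values: constants, operators, $\lambda$, $\mathtt T\lambda$ and $\mathtt I\lambda$ whose body is a value, and boxes whose content is a value. *Typing* $\Theta;\Delta;\Gamma\vdash e:\tau$ (and likewise for atoms) is the least relation that is closed under $\cong$ and under the following rules; in each rule for a compound expression the tag has to be $\cong$ to the type in the conclusion. - A variable has its type in $\Gamma$; constants and operators have their given types. - $(\mathtt{array}\ (n\ldots)\ \mathfrak a\ldots):\mathtt{Arr}\,\tau\,(\mathtt{shape}\ n\ldots)$ if there are $\prod n$ atoms, all of type $\tau$, of kind $\mathtt{Atom}$. - $(\mathtt{frame}\ (n\ldots)\ e\ldots):\mathtt{Arr}\,\tau\,(\mathbin{+\!+}\ (\mathtt{shape}\ n\ldots)\ \iota)$ if there are $\prod n$ cells, all of type $\mathtt{Arr}\,\tau\,\iota$, of kind $\mathtt{Array}$. - $(e_f\ e_1\cdots e_m):\mathtt{Arr}\,\tau_o\,(\mathbin{+\!+}\ \iota_p\ \iota_o)$ if $e_f:\mathtt{Arr}\,((\mathtt{Arr}\,\tau_1\,\iota_1)\cdots(\mathtt{Arr}\,\tau_m\,\iota_m)\to\mathtt{Arr}\,\tau_o\,\iota_o)\,\iota_f$,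 $e_i:\mathtt{Arr}\,\tau_i\,(\mathbin{+\!+}\ \iota_{a,i}\ \iota_i)$ for all $i$, and $\iota_p=\mathrm{Max}(\iota_f,\iota_{a,1},\ldots,\iota_{a,m})$. - If $e:\mathtt{Arr}\,(\forall(x::k\ldots).\mathtt{Arr}\,\tau_u\,\iota_u)\,\iota_f$ and the types $\tau'\ldots$ have the kinds $k\ldots$, then $e$ applied to $\tau'\ldots$ has type $\mathtt{Arr}\,\tau_u[\tau'/x]\,(\mathbin{+\!+}\ \iota_f\ \iota_u)$. - If $e:\mathtt{Arr}\,(\Pi(x::\gamma\ldots).\mathtt{Arr}\,\tau_u\,\iota_u)\,\iota_f$ and the indices $\iota'\ldots$ have the sorts $\gamma\ldots$, then $e$ applied to $\iota'\ldots$ has type $\mathtt{Arr}\,\tau_u[\iota'/x]\,(\mathbin{+\!+}\ \iota_f\ \iota_u[\iota'/x])$. - $\mathtt{unbox}\ (x\ldots\ y\ e)\ e':\mathtt{Arr}\,\tau_b\,(\mathbin{+\!+}\ \iota_s\ \iota_b)$ if $e:\mathtt{Arr}\,(\Sigma(x::\gamma\ldots).\tau_s)\,\iota_s$, $e':\mathtt{Arr}\,\tau_b\,\iota_b$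 in the environments extended by $x::\gamma\ldots$ and $y:\tau_s$, and $\mathtt{Arr}\,\tau_b\,\iota_b$ has kind $\mathtt{Array}$ in the unextended environments. - $\lambda(x:\tau\ldots).e:(\tau\ldots)\to\tau'$ if the $\tau\ldots$ have kind $\mathtt{Array}$ and $e:\tau'$ with $x:\tau\ldots$; $\mathtt T\lambda(x::k\ldots).e:\forall(x::k\ldots).\tau$ and $\mathtt I\lambda(x::\gamma\ldots).e:\Pi(x::\gamma\ldots).\tau$ if $e$ is a value of type $\tau$ in the extended environment. - $\mathtt{box}\ \iota\ldots\ e\ \Sigma(x::\gamma\ldots).\tau:\Sigma(x::\gamma\ldots).\tau$ if this type has kind $\mathtt{Atom}$, the $\iota\ldots$ have sorts $\gamma\ldots$, and $e:\tau[\iota/x]$. *Reduction.* Each operator has a partial function $\delta$ on lists of values, such that whenever $\delta$ is defined at values of the operator's input types, its result is a closed expression of the operator's output type. The redexes are: - lift: an application of an array literal of atomic values with frame $n_f$ to array-literal values, in which the frames of the function and of the arguments (the frame of an argument being what is left of its shape when the cell shape, given by the input type in the function's tag, is removed from its end) are prefixes of one of them, $n_p$, but are not all equal to $n_p$; cells are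 replicated until every frame is $n_p$ (tags of function and arguments are adjusted); - map: such an application in which all frames are equal to $n_f\neq()$; it becomes a frame $n_f$ of the cell-wise applications; - $\beta$: a scalar array with a $\lambda$, applied to values with tags $\cong$ the input types, by substitution; $\delta$: likewise a scalar array with an operator $\mathfrak o$, applied to values with tags $\cong$ the input types of $\mathfrak o$, at which $\delta$ is defined; - type (index) application of an array of $\mathtt T\lambda$'s ($\mathtt I\lambda$'s), which becomes a frame of the instantiated bodies; unboxing an array of boxed values, which becomes a frame of copies of the body with the hidden indices and the contents substituted; - collapse: a frame $(n\ldots)$ of array-literal values of the same shape $(n'\ldots)$, tagged $\mathtt{Arr}\,\tau\,\iota$ with $\iota\equiv(\mathtt{shape}\ n\ldots\ n'\ldots)$, which becomes the array literal of shape $(n\ldots\ n'\ldots)$ of their concatenated atoms. These redexes may be contracted in call-by-value, left-to-right *evaluation contexts* $\mathbb E$, with the hole in the content of a box in an array literal (after atomic values), in a cell of a frame (after values), in the function of an application, in an argument of an application (the function and the earlier arguments being values), in the function of a type or index application, or in the box of an $\mathtt{unbox}$. Write $\mapsto$ for one step and $\mapsto^*$ for its reflexive transitive closure; $e$ *diverges*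 if there is an infinite sequence $e\mapsto e_1\mapsto e_2\mapsto\cdots$. **Theorem (Type soundness).** If $\cdot;\cdot;\cdot\vdash e:\tau$, then at least one of the following holds: 1. $e$ diverges; 2. there is a value $v$ with $e\mapsto^* v$ and $\cdot;\cdot;\cdot\vdash v:\tau$; 3. there are an evaluation context $\mathbb E$, a primitive operator $\mathfrak o$ and values $v_1,\ldots,v_m$ of the input types of $\mathfrak o$ (that is, $\cdot;\cdot;\cdot\vdash v_i:\tau^{\mathfrak o}_i$ for $i=1,\dots,m$) such that $\delta$ is undefined for $\mathfrak o$ at $v_1,\ldots,v_m$ and $e\mapsto^*\mathbb E[((\mathtt{array}\ ()\ \mathfrak o)\ v_1\cdots v_m)]$. -/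

import Mathlib

universe u

namespace Remora

/-! ## Indices

Bound and free variables are de Bruijn indices, with separate name spaces for index variables,
type variables and term variables.  A binder of `n` variables makes the indices `0, …, n - 1`
refer to its variables, in the order in which they are declared. -/

/-- Sorts of type indices: dimensions and shapes. -/
inductive Srt
  | dim
  | shape

/-- Kinds of types. -/
inductive Knd
  | atom
  | array

/-- Type indices: variables, natural numbers, shapes `(shape ι …)`, sums `(+ ι …)` of dimensions
and concatenations `(++ ι …)` of shapes. -/
inductive Idx
  | var (i : ℕ)
  | nat (n : ℕ)
  | shp (ds : List Idx)
  | add (ds : List Idx)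
  | app (ss : List Idx)

/-- The action of a renaming under `n` binders. -/
def liftR (n : ℕ) (f : ℕ → ℕ) (i : ℕ) : ℕ :=
  if i < n then i else f (i - n) + n

/-- The substitution that sends the `n` innermost variables to the entries of `l` (of length `n`)
and treats the remaining ones by `f`. -/
def scons {α : Type*} (l : List α) (f : ℕ → α) (i : ℕ) : α :=
  (l[i]?).getD (f (i - l.length))

namespace Idx

/-- The closed shape with dimensions `ns`. -/
def lit (ns : List ℕ) : Idx := shp (ns.map nat)

mutual
/-- Renaming of index variables. -/
def rename (f : ℕ → ℕ) : Idx → Idx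
  | var i => var (f i)
  | nat n => nat n
  | shp ds => shp (renameL f ds)
  | add ds => add (renameL f ds)
  | app ss => app (renameL f ss)
/-- Renaming in a list of indices. -/
def renameL (f : ℕ → ℕ) : List Idx → List Idx
  | [] => []
  | ι :: ιs => rename f ι :: renameL f ιs
end

mutual
/-- Simultaneous substitution for index variables. -/
def subst (σ : ℕ → Idx) : Idx → Idx
  | var i => σ i
  | nat n => nat n
  | shp ds => shp (substL σ ds)
  | add ds => add (substL σ ds)
  | app ss => app (substL σ ss)
/-- Substitution in a list of indices. -/
def substL (σ : ℕ → Idx) : List Idx → List Idx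
  | [] => []
  | ι :: ιs => subst σ ι :: substL σ ιs
end

/-- A substitution under `n` index binders. -/
def up (n : ℕ) (σ : ℕ → Idx) (i : ℕ) : Idx :=
  if i < n then var i else (σ (i - n)).rename (· + n)

mutual
/-- The number denoted by an index of sort `dim`, for values `d` of the dimension variables. -/
def evalDim (d : ℕ → ℕ) : Idx → ℕ
  | var i => d i
  | nat n => n
  | add ds => (evalDimL d ds).sum
  | shp _ => 0
  | app _ => 0
/-- The numbers denoted by a list of indices of sort `dim`. -/
def evalDimL (d : ℕ → ℕ) : List Idx → List ℕ
  | [] => []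
  | ι :: ιs => evalDim d ι :: evalDimL d ιs
end

mutual
/-- The sequence of numbers denoted by an index of sort `shape`, for values `d` of the dimension
variables and `s` of the shape variables. -/
def evalShape (d : ℕ → ℕ) (s : ℕ → List ℕ) : Idx → List ℕ
  | var i => s i
  | shp ds => evalDimL d ds
  | app ss => evalShapeL d s ss
  | nat _ => []
  | add _ => []
/-- The concatenation of the sequences denoted by a list of indices of sort `shape`. -/
def evalShapeL (d : ℕ → ℕ) (s : ℕ → List ℕ) : List Idx → List ℕ
  | [] => []
  | ι :: ιs => evalShape d s ι ++ evalShapeL d s ιs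
end

end Idx

/-- Sorting of indices; `Θ` lists the sorts of the index variables. -/
inductive HasSort (Θ : List Srt) : Idx → Srt → Prop
  | var {i : ℕ} {γ : Srt} : Θ[i]? = some γ → HasSort Θ (.var i) γ
  | nat (n : ℕ) : HasSort Θ (.nat n) .dim
  | shp {ds : List Idx} : (∀ ι ∈ ds, HasSort Θ ι .dim) → HasSort Θ (.shp ds) .shape
  | add {ds : List Idx} : (∀ ι ∈ ds, HasSort Θ ι .dim) → HasSort Θ (.add ds) .dim
  | app {ss : List Idx} : (∀ ι ∈ ss, HasSort Θ ι .shape) → HasSort Θ (.app ss) .shape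

/-- Equality of shapes in the theory of indices: the two (well-sorted) shapes denote the same
sequence of numbers whatever values their variables take. -/
def IdxEqv (Θ : List Srt) (ι ι' : Idx) : Prop :=
  HasSort Θ ι .shape ∧ HasSort Θ ι' .shape ∧
    ∀ (d : ℕ → ℕ) (s : ℕ → List ℕ), ι.evalShape d s = ι'.evalShape d s

/-- The order on shapes: `ι` is a prefix of `ι'`. -/
def Prefix (Θ : List Srt) (ι ι' : Idx) : Prop :=
  ∃ w : Idx, IdxEqv Θ (.app [ι, w]) ι'

/-- `ιp` is the maximum of the shapes `l`: it is one of them, and all are prefixes of it. -/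
def IsMax (Θ : List Srt) (ιp : Idx) (l : List Idx) : Prop :=
  ιp ∈ l ∧ ∀ ι ∈ l, Prefix Θ ι ιp

/-! ## Types -/

/-- Types over a set `B` of base types: `all`, `pi` and `sigma` bind type variables, index
variables and index variables, respectively, with the given kinds or sorts. -/
inductive Ty (B : Type u) : Type u
  | var (i : ℕ)
  | base (b : B)
  | fn (ins : List (Ty B)) (out : Ty B)
  | all (ks : List Knd) (body : Ty B)
  | pi (γs : List Srt) (body : Ty B)
  | sigma (γs : List Srt) (body : Ty B)
  | arr (τ : Ty B) (ι : Idx)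

namespace Ty

variable {B : Type u}

mutual
/-- Renaming of index variables (`f`) and of type variables (`g`). -/
def rename (f g : ℕ → ℕ) : Ty B → Ty B
  | var i => var (g i)
  | base b => base b
  | fn ins out => fn (renameL f g ins) (rename f g out)
  | all ks τ => all ks (rename f (liftR ks.length g) τ)
  | pi γs τ => pi γs (rename (liftR γs.length f) g τ)
  | sigma γs τ => sigma γs (rename (liftR γs.length f) g τ)
  | arr τ ι => arr (rename f g τ) (ι.rename f)
/-- Renaming in a list of types. -/
def renameL (f g : ℕ → ℕ) : List (Ty B) → List (Ty B)
  | [] => []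
  | τ :: τs => rename f g τ :: renameL f g τs
end

/-- Shifting the index variables of a type by `n`. -/
def shiftI (n : ℕ) (τ : Ty B) : Ty B := τ.rename (· + n) id

/-- Shifting the type variables of a type by `n`. -/
def shiftT (n : ℕ) (τ : Ty B) : Ty B := τ.rename id (· + n)

/-- A type substitution under `n` type binders. -/
def up (n : ℕ) (θ : ℕ → Ty B) (i : ℕ) : Ty B :=
  if i < n then var i else (θ (i - n)).shiftT n

mutual
/-- Simultaneous substitution for index variables (`σ`) and type variables (`θ`). -/
def subst (σ : ℕ → Idx) (θ : ℕ → Ty B) : Ty B → Ty B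
  | var i => θ i
  | base b => base b
  | fn ins out => fn (substL σ θ ins) (subst σ θ out)
  | all ks τ => all ks (subst σ (up ks.length θ) τ)
  | pi γs τ => pi γs (subst (Idx.up γs.length σ) (fun i => (θ i).shiftI γs.length) τ)
  | sigma γs τ => sigma γs (subst (Idx.up γs.length σ) (fun i => (θ i).shiftI γs.length) τ)
  | arr τ ι => arr (subst σ θ τ) (ι.subst σ)
/-- Substitution in a list of types. -/
def substL (σ : ℕ → Idx) (θ : ℕ → Ty B) : List (Ty B) → List (Ty B)
  | [] => []
  | τ :: τs => subst σ θ τ :: substL σ θ τs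
end

/-- Replacing the outermost bound type variables by `τs`. -/
def instT (τs : List (Ty B)) (τ : Ty B) : Ty B := τ.subst .var (scons τs .var)

/-- Replacing the outermost bound index variables by `ιs`. -/
def instI (ιs : List Idx) (τ : Ty B) : Ty B := τ.subst (scons ιs .var) .var

end Ty

/-- Kinding of types; `Θ` lists the sorts of the index variables and `Δ` the kinds of the type
variables. -/
inductive HasKind {B : Type u} : List Srt → List Knd → Ty B → Knd → Prop
  | var {Θ : List Srt} {Δ : List Knd} {i : ℕ} {k : Knd} :
      Δ[i]? = some k → HasKind Θ Δ (.var i) k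
  | base {Θ : List Srt} {Δ : List Knd} (b : B) : HasKind Θ Δ (.base b) .atom
  | fn {Θ : List Srt} {Δ : List Knd} {ins : List (Ty B)} {out : Ty B} :
      (∀ τ ∈ ins, HasKind Θ Δ τ .array) → HasKind Θ Δ out .array →
      HasKind Θ Δ (.fn ins out) .atom
  | all {Θ : List Srt} {Δ : List Knd} {ks : List Knd} {τ : Ty B} :
      HasKind Θ (ks ++ Δ) τ .array → HasKind Θ Δ (.all ks τ) .atom
  | pi {Θ : List Srt} {Δ : List Knd} {γs : List Srt} {τ : Ty B} :
      HasKind (γs ++ Θ) Δ τ .array → HasKind Θ Δ (.pi γs τ) .atom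
  | sigma {Θ : List Srt} {Δ : List Knd} {γs : List Srt} {τ : Ty B} :
      HasKind (γs ++ Θ) Δ τ .array → HasKind Θ Δ (.sigma γs τ) .atom
  | arr {Θ : List Srt} {Δ : List Knd} {τ : Ty B} {ι : Idx} :
      HasKind Θ Δ τ .atom → HasSort Θ ι .shape → HasKind Θ Δ (.arr τ ι) .array

/-- Type equivalence: the congruence generated by equality of shapes. -/
inductive TEqv {B : Type u} : List Srt → Ty B → Ty B → Prop
  | refl {Θ : List Srt} (τ : Ty B) : TEqv Θ τ τ
  | arr {Θ : List Srt} {τ τ' : Ty B} {ι ι' : Idx} :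
      TEqv Θ τ τ' → IdxEqv Θ ι ι' → TEqv Θ (.arr τ ι) (.arr τ' ι')
  | fn {Θ : List Srt} {ins ins' : List (Ty B)} {out out' : Ty B} :
      ins.length = ins'.length → (∀ p ∈ ins.zip ins', TEqv Θ p.1 p.2) → TEqv Θ out out' →
      TEqv Θ (.fn ins out) (.fn ins' out')
  | all {Θ : List Srt} {ks : List Knd} {τ τ' : Ty B} :
      TEqv Θ τ τ' → TEqv Θ (.all ks τ) (.all ks τ')
  | pi {Θ : List Srt} {γs : List Srt} {τ τ' : Ty B} :
      TEqv (γs ++ Θ) τ τ' → TEqv Θ (.pi γs τ) (.pi γs τ')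
  | sigma {Θ : List Srt} {γs : List Srt} {τ τ' : Ty B} :
      TEqv (γs ++ Θ) τ τ' → TEqv Θ (.sigma γs τ) (.sigma γs τ')

/-! ## Terms -/

/-- The parameters of the language: base types, constants of base type and primitive operators,
each with a closed, well-kinded function type. -/
structure Signature where
  Base : Type u
  Const : Type u
  Op : Type u
  constTy : Const → Base
  opIn : Op → List (Ty Base)
  opOut : Op → Ty Base
  op_wf : ∀ o, HasKind [] [] (Ty.fn (opIn o) (opOut o)) Knd.atom

mutual
/-- Expressions.  Every compound expression carries as its last argument a type, by which it is
tagged.  The tag also plays the role of the annotation on array and frame forms without cells. -/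
inductive Expr (S : Signature.{u}) : Type u
  | var (x : ℕ)
  | array (dims : List ℕ) (atoms : List (Atom S)) (tag : Ty S.Base)
  | frame (dims : List ℕ) (cells : List (Expr S)) (tag : Ty S.Base)
  | app (f : Expr S) (args : List (Expr S)) (tag : Ty S.Base)
  | tapp (f : Expr S) (targs : List (Ty S.Base)) (tag : Ty S.Base)
  | iapp (f : Expr S) (iargs : List Idx) (tag : Ty S.Base)
  /-- `unbox n box body` binds `n` index variables and one term variable in `body`. -/
  | unbox (n : ℕ) (box body : Expr S) (tag : Ty S.Base)
/-- Atoms. -/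
inductive Atom (S : Signature.{u}) : Type u
  | const (c : S.Const)
  | op (o : S.Op)
  | lam (ins : List (Ty S.Base)) (body : Expr S)
  | tlam (ks : List Knd) (body : Expr S)
  | ilam (γs : List Srt) (body : Expr S)
  /-- `box ιs e τ` hides the indices `ιs` in the type of `e`; `τ` is the resulting type. -/
  | box (ιs : List Idx) (e : Expr S) (τ : Ty S.Base)
end

section Substitution

variable {S : Signature.{u}}

mutual
/-- Renaming of index variables (`f`), type variables (`g`) and term variables (`h`). -/
def Expr.rename (f g h : ℕ → ℕ) : Expr S → Expr S
  | .var x => .var (h x)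
  | .array ds as τ => .array ds (Atom.renameL f g h as) (τ.rename f g)
  | .frame ds es τ => .frame ds (Expr.renameL f g h es) (τ.rename f g)
  | .app e es τ => .app (Expr.rename f g h e) (Expr.renameL f g h es) (τ.rename f g)
  | .tapp e τs τ => .tapp (Expr.rename f g h e) (τs.map (Ty.rename f g)) (τ.rename f g)
  | .iapp e ιs τ => .iapp (Expr.rename f g h e) (ιs.map (Idx.rename f)) (τ.rename f g)
  | .unbox n e b τ =>
      .unbox n (Expr.rename f g h e) (Expr.rename (liftR n f) g (liftR 1 h) b) (τ.rename f g)
/-- Renaming in atoms. -/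
def Atom.rename (f g h : ℕ → ℕ) : Atom S → Atom S
  | .const c => .const c
  | .op o => .op o
  | .lam ins b => .lam (ins.map (Ty.rename f g)) (Expr.rename f g (liftR ins.length h) b)
  | .tlam ks b => .tlam ks (Expr.rename f (liftR ks.length g) h b)
  | .ilam γs b => .ilam γs (Expr.rename (liftR γs.length f) g h b)
  | .box ιs e τ => .box (ιs.map (Idx.rename f)) (Expr.rename f g h e) (τ.rename f g)
/-- Renaming in a list of expressions. -/
def Expr.renameL (f g h : ℕ → ℕ) : List (Expr S) → List (Expr S)
  | [] => []
  | e :: es => Expr.rename f g h e :: Expr.renameL f g h es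
/-- Renaming in a list of atoms. -/
def Atom.renameL (f g h : ℕ → ℕ) : List (Atom S) → List (Atom S)
  | [] => []
  | a :: as => Atom.rename f g h a :: Atom.renameL f g h as
end

/-- A substitution for term variables under `n` index binders. -/
def Expr.upI (n : ℕ) (ρ : ℕ → Expr S) (i : ℕ) : Expr S := (ρ i).rename (· + n) id id

/-- A substitution for term variables under `n` type binders. -/
def Expr.upT (n : ℕ) (ρ : ℕ → Expr S) (i : ℕ) : Expr S := (ρ i).rename id (· + n) id

/-- A substitution for term variables under `n` term binders. -/
def Expr.up (n : ℕ) (ρ : ℕ → Expr S) (i : ℕ) : Expr S :=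
  if i < n then .var i else (ρ (i - n)).rename id id (· + n)

mutual
/-- Simultaneous substitution for index variables (`σ`), type variables (`θ`) and term variables
(`ρ`). -/
def Expr.subst (σ : ℕ → Idx) (θ : ℕ → Ty S.Base) (ρ : ℕ → Expr S) : Expr S → Expr S
  | .var x => ρ x
  | .array ds as τ => .array ds (Atom.substL σ θ ρ as) (τ.subst σ θ)
  | .frame ds es τ => .frame ds (Expr.substL σ θ ρ es) (τ.subst σ θ)
  | .app e es τ => .app (Expr.subst σ θ ρ e) (Expr.substL σ θ ρ es) (τ.subst σ θ)
  | .tapp e τs τ => .tapp (Expr.subst σ θ ρ e) (τs.map (Ty.subst σ θ)) (τ.subst σ θ)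
  | .iapp e ιs τ => .iapp (Expr.subst σ θ ρ e) (ιs.map (Idx.subst σ)) (τ.subst σ θ)
  | .unbox n e b τ =>
      .unbox n (Expr.subst σ θ ρ e)
        (Expr.subst (Idx.up n σ) (fun i => (θ i).shiftI n) (Expr.up 1 (Expr.upI n ρ)) b)
        (τ.subst σ θ)
/-- Substitution in atoms. -/
def Atom.subst (σ : ℕ → Idx) (θ : ℕ → Ty S.Base) (ρ : ℕ → Expr S) : Atom S → Atom S
  | .const c => .const c
  | .op o => .op o
  | .lam ins b => .lam (ins.map (Ty.subst σ θ)) (Expr.subst σ θ (Expr.up ins.length ρ) b)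
  | .tlam ks b => .tlam ks (Expr.subst σ (Ty.up ks.length θ) (Expr.upT ks.length ρ) b)
  | .ilam γs b =>
      .ilam γs (Expr.subst (Idx.up γs.length σ) (fun i => (θ i).shiftI γs.length)
        (Expr.upI γs.length ρ) b)
  | .box ιs e τ => .box (ιs.map (Idx.subst σ)) (Expr.subst σ θ ρ e) (τ.subst σ θ)
/-- Substitution in a list of expressions. -/
def Expr.substL (σ : ℕ → Idx) (θ : ℕ → Ty S.Base) (ρ : ℕ → Expr S) : List (Expr S) → List (Expr S)
  | [] => []
  | e :: es => Expr.subst σ θ ρ e :: Expr.substL σ θ ρ es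
/-- Substitution in a list of atoms. -/
def Atom.substL (σ : ℕ → Idx) (θ : ℕ → Ty S.Base) (ρ : ℕ → Expr S) : List (Atom S) → List (Atom S)
  | [] => []
  | a :: as => Atom.subst σ θ ρ a :: Atom.substL σ θ ρ as
end

/-- Replacing the outermost bound term variables by `es`. -/
def Expr.instE (es : List (Expr S)) (b : Expr S) : Expr S := b.subst .var .var (scons es .var)

/-- Replacing the outermost bound type variables by `τs`. -/
def Expr.instT (τs : List (Ty S.Base)) (b : Expr S) : Expr S := b.subst .var (scons τs .var) .var

/-- Replacing the outermost bound index variables by `ιs`. -/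
def Expr.instI (ιs : List Idx) (b : Expr S) : Expr S := b.subst (scons ιs .var) .var .var

end Substitution

mutual
/-- Values: array literals whose atoms are values. -/
inductive IsVal {S : Signature.{u}} : Expr S → Prop
  | array {ds : List ℕ} {as : List (Atom S)} {τ : Ty S.Base} :
      (∀ a ∈ as, IsAtomVal a) → IsVal (.array ds as τ)
/-- Atomic values. -/
inductive IsAtomVal {S : Signature.{u}} : Atom S → Prop
  | const (c : S.Const) : IsAtomVal (.const c)
  | op (o : S.Op) : IsAtomVal (.op o)
  | lam (ins : List (Ty S.Base)) (b : Expr S) : IsAtomVal (.lam ins b)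
  | tlam {ks : List Knd} {b : Expr S} : IsVal b → IsAtomVal (.tlam ks b)
  | ilam {γs : List Srt} {b : Expr S} : IsVal b → IsAtomVal (.ilam γs b)
  | box {ιs : List Idx} {e : Expr S} {τ : Ty S.Base} : IsVal e → IsAtomVal (.box ιs e τ)
end

/-! ## Typing -/

mutual
/-- Typing of expressions; `Θ`, `Δ`, `Γ` give the sorts of the index variables, the kinds of the
type variables and the types of the term variables. The tag of a compound expression has to be
equivalent to the type that is derived for it. -/
inductive HasType {S : Signature.{u}} :
    List Srt → List Knd → List (Ty S.Base) → Expr S → Ty S.Base → Prop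
  | eqv {Θ : List Srt} {Δ : List Knd} {Γ : List (Ty S.Base)} {e : Expr S} {τ τ' : Ty S.Base} :
      HasType Θ Δ Γ e τ → TEqv Θ τ τ' → HasType Θ Δ Γ e τ'
  | var {Θ : List Srt} {Δ : List Knd} {Γ : List (Ty S.Base)} {x : ℕ} {τ : Ty S.Base} :
      Γ[x]? = some τ → HasType Θ Δ Γ (.var x) τ
  | array {Θ : List Srt} {Δ : List Knd} {Γ : List (Ty S.Base)} {ds : List ℕ}
      {as : List (Atom S)} {τ tag : Ty S.Base} :
      (∀ a ∈ as, HasAtomType Θ Δ Γ a τ) → HasKind Θ Δ τ .atom → as.length = ds.prod →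
      TEqv Θ tag (.arr τ (.lit ds)) →
      HasType Θ Δ Γ (.array ds as tag) (.arr τ (.lit ds))
  | frame {Θ : List Srt} {Δ : List Knd} {Γ : List (Ty S.Base)} {ds : List ℕ}
      {es : List (Expr S)} {τ tag : Ty S.Base} {ι : Idx} :
      (∀ e ∈ es, HasType Θ Δ Γ e (.arr τ ι)) → HasKind Θ Δ (.arr τ ι) .array →
      es.length = ds.prod →
      TEqv Θ tag (.arr τ (.app [.lit ds, ι])) →
      HasType Θ Δ Γ (.frame ds es tag) (.arr τ (.app [.lit ds, ι]))
  /-- The argument `es[i]` has cells of type `Arr τ ι`, where `(τ, ι) = cells[i]`, and frame shape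
  `frames[i]`; the function array has shape `ιf`, and `ιp` is the principal frame. -/
  | app {Θ : List Srt} {Δ : List Knd} {Γ : List (Ty S.Base)} {f : Expr S} {es : List (Expr S)}
      {cells : List (Ty S.Base × Idx)} {frames : List Idx} {τo tag : Ty S.Base}
      {ιf ιo ιp : Idx} :
      HasType Θ Δ Γ f (.arr (.fn (cells.map fun c => .arr c.1 c.2) (.arr τo ιo)) ιf) →
      es.length = cells.length → frames.length = cells.length →
      (∀ (i : ℕ) (e : Expr S) (c : Ty S.Base × Idx) (ι : Idx),
        es[i]? = some e → cells[i]? = some c → frames[i]? = some ι →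
        HasType Θ Δ Γ e (.arr c.1 (.app [ι, c.2]))) →
      IsMax Θ ιp (ιf :: frames) →
      TEqv Θ tag (.arr τo (.app [ιp, ιo])) →
      HasType Θ Δ Γ (.app f es tag) (.arr τo (.app [ιp, ιo]))
  | tapp {Θ : List Srt} {Δ : List Knd} {Γ : List (Ty S.Base)} {f : Expr S} {ks : List Knd}
      {τs : List (Ty S.Base)} {τ tag : Ty S.Base} {ιf ι : Idx} :
      HasType Θ Δ Γ f (.arr (.all ks (.arr τ ι)) ιf) →
      τs.length = ks.length → (∀ p ∈ τs.zip ks, HasKind Θ Δ p.1 p.2) →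
      TEqv Θ tag (.arr (τ.instT τs) (.app [ιf, ι])) →
      HasType Θ Δ Γ (.tapp f τs tag) (.arr (τ.instT τs) (.app [ιf, ι]))
  | iapp {Θ : List Srt} {Δ : List Knd} {Γ : List (Ty S.Base)} {f : Expr S} {γs : List Srt}
      {ιs : List Idx} {τ tag : Ty S.Base} {ιf ι : Idx} :
      HasType Θ Δ Γ f (.arr (.pi γs (.arr τ ι)) ιf) →
      ιs.length = γs.length → (∀ p ∈ ιs.zip γs, HasSort Θ p.1 p.2) →
      TEqv Θ tag (.arr (τ.instI ιs) (.app [ιf, ι.subst (scons ιs .var)])) →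
      HasType Θ Δ Γ (.iapp f ιs tag) (.arr (τ.instI ιs) (.app [ιf, ι.subst (scons ιs .var)]))
  | unbox {Θ : List Srt} {Δ : List Knd} {Γ : List (Ty S.Base)} {n : ℕ} {e b : Expr S}
      {γs : List Srt} {τ τb tag : Ty S.Base} {ιs ιb : Idx} :
      HasType Θ Δ Γ e (.arr (.sigma γs τ) ιs) → γs.length = n →
      HasType (γs ++ Θ) Δ (τ :: Γ.map (Ty.shiftI n)) b ((Ty.arr τb ιb).shiftI n) →
      HasKind Θ Δ (.arr τb ιb) .array →
      TEqv Θ tag (.arr τb (.app [ιs, ιb])) →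
      HasType Θ Δ Γ (.unbox n e b tag) (.arr τb (.app [ιs, ιb]))
/-- Typing of atoms. -/
inductive HasAtomType {S : Signature.{u}} :
    List Srt → List Knd → List (Ty S.Base) → Atom S → Ty S.Base → Prop
  | eqv {Θ : List Srt} {Δ : List Knd} {Γ : List (Ty S.Base)} {a : Atom S} {τ τ' : Ty S.Base} :
      HasAtomType Θ Δ Γ a τ → TEqv Θ τ τ' → HasAtomType Θ Δ Γ a τ'
  | const {Θ : List Srt} {Δ : List Knd} {Γ : List (Ty S.Base)} (c : S.Const) :
      HasAtomType Θ Δ Γ (.const c) (.base (S.constTy c))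
  | op {Θ : List Srt} {Δ : List Knd} {Γ : List (Ty S.Base)} (o : S.Op) :
      HasAtomType Θ Δ Γ (.op o) (.fn (S.opIn o) (S.opOut o))
  | lam {Θ : List Srt} {Δ : List Knd} {Γ : List (Ty S.Base)} {ins : List (Ty S.Base)}
      {b : Expr S} {τ : Ty S.Base} :
      (∀ τi ∈ ins, HasKind Θ Δ τi .array) → HasType Θ Δ (ins ++ Γ) b τ →
      HasAtomType Θ Δ Γ (.lam ins b) (.fn ins τ)
  | tlam {Θ : List Srt} {Δ : List Knd} {Γ : List (Ty S.Base)} {ks : List Knd}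
      {b : Expr S} {τ : Ty S.Base} :
      IsVal b → HasType Θ (ks ++ Δ) (Γ.map (Ty.shiftT ks.length)) b τ →
      HasAtomType Θ Δ Γ (.tlam ks b) (.all ks τ)
  | ilam {Θ : List Srt} {Δ : List Knd} {Γ : List (Ty S.Base)} {γs : List Srt}
      {b : Expr S} {τ : Ty S.Base} :
      IsVal b → HasType (γs ++ Θ) Δ (Γ.map (Ty.shiftI γs.length)) b τ →
      HasAtomType Θ Δ Γ (.ilam γs b) (.pi γs τ)
  | box {Θ : List Srt} {Δ : List Knd} {Γ : List (Ty S.Base)} {γs : List Srt}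
      {ιs : List Idx} {e : Expr S} {τ : Ty S.Base} :
      HasKind Θ Δ (.sigma γs τ) .atom →
      ιs.length = γs.length → (∀ p ∈ ιs.zip γs, HasSort Θ p.1 p.2) →
      HasType Θ Δ Γ e (τ.instI ιs) →
      HasAtomType Θ Δ Γ (.box ιs e (.sigma γs τ)) (.sigma γs τ)
end

/-! ## Reduction -/

/-- `split k n xs` lists `k` consecutive pieces of `xs`, each of length `n`. -/
def split {α : Type*} (k n : ℕ) (xs : List α) : List (List α) :=
  (List.range k).map fun j => (xs.drop (j * n)).take n

/-- Each piece is repeated `n` times in succession. -/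
def rep {α : Type*} (n : ℕ) (xss : List (List α)) : List (List α) :=
  xss.flatMap (List.replicate n)

/-- The `j`-th of the `k` lists in `transpose k xsss` collects the `j`-th entries of the given
lists, which have `k` entries each. -/
def transpose {α : Type*} (k : ℕ) (xsss : List (List (List α))) : List (List (List α)) :=
  (List.range k).map fun j => xsss.map fun xss => xss.getD j []

/-- An array literal in argument position: the input type of the function is `Arr cellTy cellIdx`,
the index `cellIdx` denotes the shape `cell`, and the array has shape `frame ++ cell`. -/
structure AppArg (S : Signature.{u}) where
  cellTy : Ty S.Base
  cellIdx : Idx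
  cell : List ℕ
  frame : List ℕ
  atoms : List (Atom S)
  tag : Ty S.Base

namespace AppArg

variable {S : Signature.{u}}

/-- The argument as an expression. -/
def expr (a : AppArg S) : Expr S := .array (a.frame ++ a.cell) a.atoms a.tag

/-- The input type of the function. -/
def inTy (a : AppArg S) : Ty S.Base := .arr a.cellTy a.cellIdx

/-- The data fit together, and the argument is a value. -/
def Ok (a : AppArg S) : Prop :=
  IdxEqv [] a.cellIdx (.lit a.cell) ∧
    TEqv [] a.tag (.arr a.cellTy (.lit (a.frame ++ a.cell))) ∧ IsVal a.expr

/-- The cells of the argument, as lists of atoms. -/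
def cells (a : AppArg S) : List (List (Atom S)) := split a.frame.prod a.cell.prod a.atoms

/-- The argument with cells replicated so that its frame becomes `np`. -/
def lifted (np : List ℕ) (a : AppArg S) : Expr S :=
  .array (np ++ a.cell) (rep (np.drop a.frame.length).prod a.cells).flatten
    (.arr a.cellTy (.lit (np ++ a.cell)))

end AppArg

/-- Reduction of redexes; `δ o vs` is the value of the partial primitive operator `o` at `vs`. -/
inductive Red {S : Signature.{u}} (δ : S.Op → List (Expr S) → Option (Expr S)) :
    Expr S → Expr S → Prop
  /-- Cells of the function array and of the arguments are replicated to the principal frame. -/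
  | lift {nf np : List ℕ} {fs : List (Atom S)} {args : List (AppArg S)} {ιf : Idx}
      {out tag : Ty S.Base} :
      (∀ f ∈ fs, IsAtomVal f) → (∀ a ∈ args, a.Ok) → IdxEqv [] ιf (.lit nf) →
      np ∈ nf :: args.map AppArg.frame →
      (∀ n ∈ nf :: args.map AppArg.frame, n <+: np) →
      (∃ n ∈ nf :: args.map AppArg.frame, n ≠ np) →
      Red δ
        (.app (.array nf fs (.arr (.fn (args.map AppArg.inTy) out) ιf))
          (args.map AppArg.expr) tag)
        (.app
          (.array np (rep (np.drop nf.length).prod (split nf.prod 1 fs)).flatten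
            (.arr (.fn (args.map AppArg.inTy) out) (.lit np)))
          (args.map (AppArg.lifted np)) tag)
  /-- Pointwise application, when all frames agree. -/
  | map {nf : List ℕ} {fs : List (Atom S)} {args : List (AppArg S)} {ιf : Idx}
      {out tag : Ty S.Base} :
      nf ≠ [] → fs.length = nf.prod →
      (∀ f ∈ fs, IsAtomVal f) → (∀ a ∈ args, a.Ok) → IdxEqv [] ιf (.lit nf) →
      (∀ a ∈ args, a.frame = nf) →
      Red δ
        (.app (.array nf fs (.arr (.fn (args.map AppArg.inTy) out) ιf))
          (args.map AppArg.expr) tag)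
        (.frame nf
          ((fs.zip (transpose nf.prod (args.map AppArg.cells))).map fun p =>
            .app (.array [] [p.1] (.arr (.fn (args.map AppArg.inTy) out) (.lit [])))
              ((args.zip p.2).map fun q =>
                .array q.1.cell q.2 (.arr q.1.cellTy (.lit q.1.cell)))
              out)
          tag)
  | beta {ins : List (Ty S.Base)} {b : Expr S} {args : List (Expr S)} {tagf tag : Ty S.Base} :
      (∀ v ∈ args, IsVal v) → args.length = ins.length →
      (∀ p ∈ args.zip ins, ∃ ds as τ, p.1 = .array ds as τ ∧ TEqv [] τ p.2) →
      Red δ (.app (.array [] [.lam ins b] tagf) args tag) (b.instE args)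
  | delta {o : S.Op} {args : List (Expr S)} {tagf tag : Ty S.Base} {e : Expr S} :
      (∀ v ∈ args, IsVal v) → args.length = (S.opIn o).length →
      (∀ p ∈ args.zip (S.opIn o), ∃ ds as τ, p.1 = .array ds as τ ∧ TEqv [] τ p.2) →
      δ o args = some e →
      Red δ (.app (.array [] [.op o] tagf) args tag) e
  | tbeta {ds : List ℕ} {fs : List (List Knd × Expr S)} {τs : List (Ty S.Base)}
      {tagf tag : Ty S.Base} :
      (∀ f ∈ fs, IsVal f.2 ∧ f.1.length = τs.length) →
      Red δ (.tapp (.array ds (fs.map fun f => .tlam f.1 f.2) tagf) τs tag)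
        (.frame ds (fs.map fun f => f.2.instT τs) tag)
  | ibeta {ds : List ℕ} {fs : List (List Srt × Expr S)} {ιs : List Idx}
      {tagf tag : Ty S.Base} :
      (∀ f ∈ fs, IsVal f.2 ∧ f.1.length = ιs.length) →
      Red δ (.iapp (.array ds (fs.map fun f => .ilam f.1 f.2) tagf) ιs tag)
        (.frame ds (fs.map fun f => f.2.instI ιs) tag)
  | unbox {ds : List ℕ} {bs : List (List Idx × Expr S × Ty S.Base)} {n : ℕ} {b : Expr S}
      {tagb tag : Ty S.Base} :
      (∀ c ∈ bs, IsVal c.2.1 ∧ c.1.length = n) →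
      Red δ (.unbox n (.array ds (bs.map fun c => .box c.1 c.2.1 c.2.2) tagb) b tag)
        (.frame ds (bs.map fun c => b.subst (scons c.1 .var) .var (scons [c.2.1] .var)) tag)
  /-- A frame of array literals collapses to one array literal. The cell shape `n'` is read off
  the tag, which is needed if there are no cells. -/
  | collapse {n n' : List ℕ} {cells : List (List (Atom S) × Ty S.Base)} {τ : Ty S.Base}
      {ι : Idx} :
      (∀ c ∈ cells, ∀ a ∈ c.1, IsAtomVal a) → IdxEqv [] ι (.lit (n ++ n')) →
      Red δ (.frame n (cells.map fun c => .array n' c.1 c.2) (.arr τ ι))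
        (.array (n ++ n') (cells.map Prod.fst).flatten (.arr τ ι))

/-- Evaluation contexts: call by value, from left to right. -/
inductive Ctx (S : Signature.{u}) : Type u
  | hole
  | box (ds : List ℕ) (pre : List (Atom S)) (hpre : ∀ a ∈ pre, IsAtomVal a) (ιs : List Idx)
      (E : Ctx S) (τ : Ty S.Base) (post : List (Atom S)) (tag : Ty S.Base)
  | frame (ds : List ℕ) (pre : List (Expr S)) (hpre : ∀ e ∈ pre, IsVal e) (E : Ctx S)
      (post : List (Expr S)) (tag : Ty S.Base)
  | appFun (E : Ctx S) (args : List (Expr S)) (tag : Ty S.Base)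
  | appArg (f : Expr S) (hf : IsVal f) (pre : List (Expr S)) (hpre : ∀ e ∈ pre, IsVal e)
      (E : Ctx S) (post : List (Expr S)) (tag : Ty S.Base)
  | tapp (E : Ctx S) (τs : List (Ty S.Base)) (tag : Ty S.Base)
  | iapp (E : Ctx S) (ιs : List Idx) (tag : Ty S.Base)
  | unbox (n : ℕ) (E : Ctx S) (b : Expr S) (tag : Ty S.Base)

/-- Filling the hole of an evaluation context. -/
def Ctx.fill {S : Signature.{u}} (e : Expr S) : Ctx S → Expr S
  | .hole => e
  | .box ds pre _ ιs E τ post tag => .array ds (pre ++ .box ιs (E.fill e) τ :: post) tag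
  | .frame ds pre _ E post tag => .frame ds (pre ++ E.fill e :: post) tag
  | .appFun E args tag => .app (E.fill e) args tag
  | .appArg f _ pre _ E post tag => .app f (pre ++ E.fill e :: post) tag
  | .tapp E τs tag => .tapp (E.fill e) τs tag
  | .iapp E ιs tag => .iapp (E.fill e) ιs tag
  | .unbox n E b tag => .unbox n (E.fill e) b tag

/-- One step of reduction. -/
inductive Step {S : Signature.{u}} (δ : S.Op → List (Expr S) → Option (Expr S)) :
    Expr S → Expr S → Prop
  | mk (E : Ctx S) {e e' : Expr S} : Red δ e e' → Step δ (E.fill e) (E.fill e')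

/-- The expression `e` starts an infinite sequence of reduction steps. -/
def Diverges {S : Signature.{u}} (δ : S.Op → List (Expr S) → Option (Expr S)) (e : Expr S) :
    Prop :=
  ∃ f : ℕ → Expr S, f 0 = e ∧ ∀ n, Step δ (f n) (f (n + 1))

/-- The arguments `vs` of the primitive operator `o` are values of its input types. -/
def ArgsOk {S : Signature.{u}} (o : S.Op) (vs : List (Expr S)) : Prop :=
  (∀ v ∈ vs, IsVal v) ∧ vs.length = (S.opIn o).length ∧
    ∀ p ∈ vs.zip (S.opIn o), HasType [] [] [] p.1 p.2

end Remora

-- Soundness is progress together with preservation. If every reduct of `e` makes a step, dependent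
-- choice yields an infinite reduction. Otherwise some reduct has no step. It keeps the type of `e`
-- by `Step.preservation`, so by `HasType.progress` it is a value or is stuck at an undefined
-- application of an operator.
--
-- Two features need care. The first is conversion: a derivation may end in type equivalences.
-- Equivalence has no transitivity rule, but transitivity is admissible (`TEqv.trans`), so all final
-- conversions merge into one in `HasType.inversion`. Equality of shapes includes well-sortedness,
-- and regularity (`HasType.hasKind`) supplies it. For closed shapes, equality then amounts to
-- equality of the sequences `Idx.val` (`idxEqv_nil_iff`), so questions about frames become
-- questions about lists of numbers.
--
-- The second is that reduction reads tags. The typing rules make every tag equivalent to the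
-- derived type, so the frames that a redex computes from tags agree with those of the derivation:
-- an argument has shape frame followed by cell, the function's tag fixes the cell, and the cell can
-- be cancelled on the right (`HasType.app_lit_inv`). The principal frame is unique because the
-- prefix order is antisymmetric.
--
-- Preservation for the instantiating redexes rests on simultaneous substitution for all three sorts
-- of variables (`HasType.subst`). For lift, map and collapse it is a count of atoms. Holes of
-- evaluation contexts lie under no binder, so replacing the contents of a hole stays within closed
-- typing (`Ctx.hasType_fill`).
--
-- Progress uses canonical forms. For applications (`canProceed_app`) the frames are compared with
-- the principal one: if some frame differs, the redex is a lift; if all agree and are nonempty, a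
-- map; if all are empty, the function is a single abstraction or operator.

namespace Remora

/-! ## Algebra of index substitution -/

namespace Idx

/-- Induction on indices, with the hypothesis for all members of the lists of components. -/
@[elab_as_elim]
theorem inductionOn {P : Idx → Prop} (var : ∀ i, P (var i)) (nat : ∀ n, P (nat n))
    (shp : ∀ ds, (∀ ι ∈ ds, P ι) → P (shp ds)) (add : ∀ ds, (∀ ι ∈ ds, P ι) → P (add ds))
    (app : ∀ ds, (∀ ι ∈ ds, P ι) → P (app ds)) (ι : Idx) : P ι :=
  Idx.rec (motive_1 := P) (motive_2 := fun l => ∀ ι ∈ l, P ι) var nat shp add app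
    (by simp) (by intro a l ha hl; simpa using ⟨ha, hl⟩) ι

@[simp] theorem renameL_eq_map (f : ℕ → ℕ) (l : List Idx) : renameL f l = l.map (rename f) := by
  induction l <;> simp_all [renameL]

@[simp] theorem substL_eq_map (σ : ℕ → Idx) (l : List Idx) : substL σ l = l.map (subst σ) := by
  induction l <;> simp_all [substL]

@[simp] theorem evalDimL_eq_map (d : ℕ → ℕ) (l : List Idx) :
    evalDimL d l = l.map (evalDim d) := by
  induction l <;> simp_all [evalDimL]

@[simp] theorem evalShapeL_eq_flatMap (d : ℕ → ℕ) (s : ℕ → List ℕ) (l : List Idx) :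
    evalShapeL d s l = l.flatMap (evalShape d s) := by
  induction l <;> simp_all [evalShapeL]

/-- Since indices bind nothing, this reduces every law about renaming indices to one about
substitution. -/
theorem rename_eq_subst (f : ℕ → ℕ) (ι : Idx) : ι.rename f = ι.subst fun i => var (f i) := by
  induction ι using inductionOn <;> simp_all [rename, subst]

theorem subst_subst (σ σ' : ℕ → Idx) (ι : Idx) :
    (ι.subst σ).subst σ' = ι.subst fun i => (σ i).subst σ' := by
  induction ι using inductionOn <;> simp_all [subst]

@[simp] theorem subst_var (ι : Idx) : ι.subst var = ι := by
  induction ι using inductionOn with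
  | var | nat => simp [subst]
  | shp l ih | add l ih | app l ih =>
    simpa [subst] using (List.map_congr_left ih).trans l.map_id

theorem evalDim_subst (d : ℕ → ℕ) (σ : ℕ → Idx) (ι : Idx) :
    (ι.subst σ).evalDim d = ι.evalDim fun i => (σ i).evalDim d := by
  induction ι using inductionOn with
  | var | nat | shp | app => simp [subst, evalDim]
  | add l ih =>
    simp only [subst, evalDim, substL_eq_map, evalDimL_eq_map, List.map_map]
    exact congrArg List.sum (List.map_congr_left ih)

theorem evalShape_subst (d : ℕ → ℕ) (s : ℕ → List ℕ) (σ : ℕ → Idx) (ι : Idx) :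
    (ι.subst σ).evalShape d s =
      ι.evalShape (fun i => (σ i).evalDim d) fun i => (σ i).evalShape d s := by
  induction ι using inductionOn with
  | var | nat | add => simp [subst, evalShape]
  | shp l => simp [subst, evalShape, evalDim_subst]
  | app l ih =>
    simp only [subst, evalShape, substL_eq_map, evalShapeL_eq_flatMap, List.flatMap_map]
    exact List.flatMap_congr ih

@[simp] theorem evalShape_lit (d : ℕ → ℕ) (s : ℕ → List ℕ) (ns : List ℕ) :
    (lit ns).evalShape d s = ns := by
  simp [lit, evalShape, Function.comp_def, evalDim]

@[simp] theorem subst_lit (σ : ℕ → Idx) (ns : List ℕ) : (lit ns).subst σ = lit ns := by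
  simp [lit, subst, Function.comp_def]

theorem up_var (n : ℕ) (f : ℕ → ℕ) : up n (fun i => var (f i)) = fun i => var (liftR n f i) := by
  funext i; simp only [up, liftR, rename]; split <;> rfl

theorem up_var' (n : ℕ) : up n var = var := by
  funext i; simp only [up, rename]; split
  · rfl
  · congr 1; omega

theorem up_liftR (n : ℕ) (σ : ℕ → Idx) (f : ℕ → ℕ) :
    (fun i => up n σ (liftR n f i)) = up n fun i => σ (f i) := by
  funext i; simp only [up, liftR]; split <;> simp_all

theorem up_add (n : ℕ) (σ : ℕ → Idx) (i : ℕ) : up n σ (i + n) = (σ i).rename (· + n) := by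
  simp [up]

theorem up_subst_up (n : ℕ) (σ σ' : ℕ → Idx) :
    (fun i => (up n σ i).subst (up n σ')) = up n fun i => (σ i).subst σ' := by
  funext i
  simp only [up]
  split
  · rename_i h; simp [subst, up, h]
  · simp [rename_eq_subst, subst_subst, subst, up]

/-- Commutation of instantiation with substitution, variable by variable: a bound variable goes to a
substituted entry on both sides, and for a free one the instantiation undoes the shift made by `up`.
-/
theorem scons_subst (n : ℕ) (ιs : List Idx) (h : ιs.length = n) (σ : ℕ → Idx) :
    (fun i => (scons ιs var i).subst σ) =
      fun i => (up n σ i).subst (scons (ιs.map (subst σ)) var) := by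
  subst h
  funext i
  simp only [up]
  split
  · rename_i h; simp [scons, subst, h]
  · rename_i h
    simp [scons, rename_eq_subst, subst_subst, subst, List.getElem?_eq_none (not_lt.mp h)]

theorem inst_subst (ιs : List Idx) (n : ℕ) (h : ιs.length = n) (σ : ℕ → Idx) (ι : Idx) :
    (ι.subst (scons ιs var)).subst σ =
      (ι.subst (up n σ)).subst (scons (ιs.map (subst σ)) var) := by
  rw [subst_subst, subst_subst, scons_subst n ιs h]

end Idx

@[simp] theorem scons_add {α : Type*} (l : List α) (f : ℕ → α) (i : ℕ) :
    scons l f (i + l.length) = f i := by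
  simp [scons]

/-! ## Algebra of type substitution -/

namespace Ty

variable {B : Type u}

/-- Induction on types, with the hypothesis for all input types of a function type. -/
@[elab_as_elim]
theorem inductionOn {P : Ty B → Prop} (var : ∀ i, P (var i)) (base : ∀ b, P (base b))
    (fn : ∀ ins out, (∀ τ ∈ ins, P τ) → P out → P (fn ins out))
    (all : ∀ ks τ, P τ → P (all ks τ)) (pi : ∀ γs τ, P τ → P (pi γs τ))
    (sigma : ∀ γs τ, P τ → P (sigma γs τ)) (arr : ∀ τ ι, P τ → P (arr τ ι)) (τ : Ty B) : P τ :=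
  Ty.rec (motive_1 := P) (motive_2 := fun l => ∀ ι ∈ l, P ι) var base fn all pi sigma arr
    (by simp) (by intro a l ha hl; simpa using ⟨ha, hl⟩) τ

@[simp] theorem renameL_eq_map (f g : ℕ → ℕ) (l : List (Ty B)) :
    renameL f g l = l.map (rename f g) := by
  induction l <;> simp_all [renameL]

@[simp] theorem substL_eq_map (σ : ℕ → Idx) (θ : ℕ → Ty B) (l : List (Ty B)) :
    substL σ θ l = l.map (subst σ θ) := by
  induction l <;> simp_all [substL]

theorem up_var (n : ℕ) (f : ℕ → ℕ) :
    up n (fun i => (var (f i) : Ty B)) = fun i => var (liftR n f i) := by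
  funext i; simp only [up, liftR, shiftT, rename]; split <;> rfl

theorem up_var' (n : ℕ) : up n (var : ℕ → Ty B) = var := by
  funext i; simp only [up, shiftT, rename]; split
  · rfl
  · congr 1; omega

theorem up_liftR (n : ℕ) (θ : ℕ → Ty B) (f : ℕ → ℕ) :
    (fun i => up n θ (liftR n f i)) = up n fun i => θ (f i) := by
  funext i; simp only [up, liftR]; split <;> simp_all

theorem rename_eq_subst (f g : ℕ → ℕ) (τ : Ty B) :
    τ.rename f g = τ.subst (fun i => .var (f i)) fun i => .var (g i) := by
  induction τ using inductionOn generalizing f g <;>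
    simp_all [rename, subst, Idx.rename_eq_subst, up_var, Idx.up_var, shiftI]

/-- The composition laws come in a fixed order, since lifting a substitution under a binder itself
renames: first substitution after renaming, then renaming after substitution, and with both,
substitution after substitution. -/
theorem subst_rename (f g : ℕ → ℕ) (σ : ℕ → Idx) (θ : ℕ → Ty B) (τ : Ty B) :
    (τ.rename f g).subst σ θ = τ.subst (fun i => σ (f i)) fun i => θ (g i) := by
  induction τ using inductionOn generalizing f g σ θ <;>
    simp_all [rename, subst, Idx.rename_eq_subst, up_liftR, Idx.up_liftR, Idx.subst_subst,
      Idx.subst]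

theorem rename_rename (f g f' g' : ℕ → ℕ) (τ : Ty B) :
    (τ.rename f g).rename f' g' = τ.rename (fun i => f' (f i)) fun i => g' (g i) := by
  rw [rename_eq_subst, subst_rename, rename_eq_subst]

theorem liftR_add (n : ℕ) (f : ℕ → ℕ) (i : ℕ) : liftR n f (i + n) = f i + n := by
  simp [liftR]

theorem rename_subst (f g : ℕ → ℕ) (σ : ℕ → Idx) (θ : ℕ → Ty B) (τ : Ty B) :
    (τ.subst σ θ).rename f g =
      τ.subst (fun i => (σ i).rename f) fun i => (θ i).rename f g := by
  -- Lifting commutes with renaming; for indices this is already an instance of composing lifted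
  -- substitutions.
  have key : ∀ n (f : ℕ → ℕ) (σ : ℕ → Idx), (fun i => (Idx.up n σ i).rename (liftR n f)) =
      Idx.up n fun i => (σ i).rename f := by
    intro n f σ
    simp only [Idx.rename_eq_subst, ← Idx.up_var, Idx.up_subst_up]
  have key' : ∀ n (f g : ℕ → ℕ) (θ : ℕ → Ty B), (fun i => (up n θ i).rename f (liftR n g)) =
      up n fun i => (θ i).rename f g := by
    intro n f g θ
    funext i
    simp only [up]
    split
    · rename_i h; simp [rename, liftR, h]
    · simp [shiftT, rename_rename, liftR_add]
  induction τ using inductionOn generalizing f g σ θ <;>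
    simp_all [rename, subst, Idx.rename_eq_subst, Idx.subst_subst, shiftI, rename_rename,
      liftR_add]

theorem up_subst_up (n : ℕ) (σ : ℕ → Idx) (θ θ' : ℕ → Ty B) :
    (fun i => (up n θ i).subst σ (up n θ')) = up n fun i => (θ i).subst σ θ' := by
  funext i
  simp only [up]
  split
  · rename_i h; simp [subst, up, h]
  · simp [shiftT, subst_rename, rename_subst, Idx.rename_eq_subst, up]

theorem shiftI_subst_up (n : ℕ) (σ : ℕ → Idx) (θ : ℕ → Ty B) (τ : Ty B) :
    (τ.shiftI n).subst (Idx.up n σ) (fun i => (θ i).shiftI n) = (τ.subst σ θ).shiftI n := by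
  simp [shiftI, subst_rename, rename_subst, Idx.up_add]

theorem shiftT_subst_up (n : ℕ) (σ : ℕ → Idx) (θ : ℕ → Ty B) (τ : Ty B) :
    (τ.shiftT n).subst σ (up n θ) = (τ.subst σ θ).shiftT n := by
  simp [shiftT, subst_rename, rename_subst, up, Idx.rename_eq_subst]

/-- At each binder the claim is that lifted substitutions compose to the lift of the composite. An
index binder also shifts the values of the type substitution, hence `shiftI_subst_up`. -/
theorem subst_subst (σ σ' : ℕ → Idx) (θ θ' : ℕ → Ty B) (τ : Ty B) :
    (τ.subst σ θ).subst σ' θ' =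
      τ.subst (fun i => (σ i).subst σ') fun i => (θ i).subst σ' θ' := by
  induction τ using inductionOn generalizing σ θ σ' θ' <;>
    simp_all [subst, Idx.subst_subst, up_subst_up, Idx.up_subst_up, shiftI_subst_up]

theorem shiftI_var (n i : ℕ) : (var i : Ty B).shiftI n = var i := rfl

@[simp] theorem subst_var (τ : Ty B) : τ.subst .var .var = τ := by
  induction τ using inductionOn with
  | fn ins out ih ih' =>
    simpa [subst, ih'] using (List.map_congr_left ih).trans ins.map_id
  | _ => simp_all [subst, up_var', Idx.up_var', shiftI_var]

theorem rename_id (τ : Ty B) : τ.rename id id = τ := by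
  simp [rename_eq_subst]

theorem instT_subst (τs : List (Ty B)) (n : ℕ) (h : τs.length = n) (σ : ℕ → Idx)
    (θ : ℕ → Ty B) (τ : Ty B) :
    (τ.instT τs).subst σ θ = (τ.subst σ (up n θ)).instT (τs.map (subst σ θ)) := by
  subst h
  simp only [instT, subst_subst, Idx.subst_var]
  congr 1
  funext i
  simp only [up]
  split
  · rename_i h; simp [scons, subst, h]
  · rename_i h
    simp [scons, shiftT, subst_rename, subst, List.getElem?_eq_none (not_lt.mp h)]

theorem shiftI_subst_scons (ιs : List Idx) (n : ℕ) (h : ιs.length = n) (σ : ℕ → Idx)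
    (θ : ℕ → Ty B) (τ : Ty B) : (τ.shiftI n).subst (scons ιs σ) θ = τ.subst σ θ := by
  subst h; simp [shiftI, subst_rename]

theorem instI_subst (ιs : List Idx) (n : ℕ) (h : ιs.length = n) (σ : ℕ → Idx)
    (θ : ℕ → Ty B) (τ : Ty B) :
    (τ.instI ιs).subst σ θ =
      (τ.subst (Idx.up n σ) fun i => (θ i).shiftI n).instI (ιs.map (Idx.subst σ)) := by
  simp only [instI, subst_subst, Idx.scons_subst n ιs h]
  congr 1
  funext i
  rw [shiftI_subst_scons _ _ (by simpa using h), subst_var]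
  rfl

end Ty

/-! ## Sorting -/

/-- The index substitution `σ` respects sorts. -/
def SortSub (Θ Θ' : List Srt) (σ : ℕ → Idx) : Prop :=
  ∀ i γ, Θ[i]? = some γ → HasSort Θ' (σ i) γ

/-- The renaming `f` respects the entries of environments. -/
def Ren {α : Type*} (L L' : List α) (f : ℕ → ℕ) : Prop :=
  ∀ i a, L[i]? = some a → L'[f i]? = some a

theorem Ren.lift {α : Type*} {L L' : List α} {f : ℕ → ℕ} (h : Ren L L' f) (M : List α) :
    Ren (M ++ L) (M ++ L') (liftR M.length f) := by
  intro i a hi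
  rcases lt_or_ge i M.length with hl | hl
  · rw [List.getElem?_append_left hl] at hi
    rw [liftR, if_pos hl, List.getElem?_append_left hl, hi]
  · rw [List.getElem?_append_right hl] at hi
    rw [liftR, if_neg (not_lt.mpr hl), List.getElem?_append_right (by omega)]
    simpa using h _ _ hi

theorem ren_add {α : Type*} (L M : List α) : Ren L (M ++ L) (· + M.length) := by
  intro i a hi
  simpa [List.getElem?_append_right] using hi

theorem ren_id {α : Type*} (L : List α) : Ren L L id := fun _ _ h => h

theorem Ren.map {α β : Type*} {L L' : List α} {f : ℕ → ℕ} (h : Ren L L' f) (g : α → β) :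
    Ren (L.map g) (L'.map g) f := by
  intro i b hb
  simp only [List.getElem?_map, Option.map_eq_some_iff] at hb ⊢
  obtain ⟨a, ha, rfl⟩ := hb
  exact ⟨a, h _ _ ha, rfl⟩

theorem Ren.sortSub {Θ Θ' : List Srt} {f : ℕ → ℕ} (h : Ren Θ Θ' f) :
    SortSub Θ Θ' fun i => .var (f i) :=
  fun i γ hi => .var (h i γ hi)

theorem HasSort.subst {Θ Θ' : List Srt} {σ : ℕ → Idx} (hσ : SortSub Θ Θ' σ) {ι : Idx} {γ : Srt}
    (h : HasSort Θ ι γ) : HasSort Θ' (ι.subst σ) γ := by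
  induction h with
  | var h => exact hσ _ _ h
  | nat n => exact .nat n
  | shp _ ih => rw [Idx.subst, Idx.substL_eq_map]; exact .shp (by simpa using ih)
  | add _ ih => rw [Idx.subst, Idx.substL_eq_map]; exact .add (by simpa using ih)
  | app _ ih => rw [Idx.subst, Idx.substL_eq_map]; exact .app (by simpa using ih)

theorem hasSort_lit (Θ : List Srt) (ns : List ℕ) : HasSort Θ (.lit ns) .shape :=
  .shp (by simp only [List.mem_map]; rintro _ ⟨n, -, rfl⟩; exact .nat n)

theorem hasSort_app {Θ : List Srt} {ι ι' : Idx} :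
    HasSort Θ (.app [ι, ι']) .shape ↔ HasSort Θ ι .shape ∧ HasSort Θ ι' .shape := by
  constructor
  · rintro ⟨⟩; simp_all
  · intro h; exact .app (by simpa using h)

theorem SortSub.up {Θ Θ' : List Srt} {σ : ℕ → Idx} (h : SortSub Θ Θ' σ) (γs : List Srt) :
    SortSub (γs ++ Θ) (γs ++ Θ') (Idx.up γs.length σ) := by
  intro i γ hi
  rcases lt_or_ge i γs.length with hl | hl
  · rw [Idx.up, if_pos hl]
    rw [List.getElem?_append_left hl] at hi
    exact .var (by rwa [List.getElem?_append_left hl])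
  · rw [List.getElem?_append_right hl] at hi
    rw [Idx.up, if_neg (not_lt.mpr hl), Idx.rename_eq_subst]
    exact (h _ _ hi).subst (ren_add Θ' γs).sortSub

theorem sortSub_var (Θ : List Srt) : SortSub Θ Θ .var := fun _ _ h => .var h

theorem sortSub_scons {Θ Θ' γs : List Srt} {ιs : List Idx} {σ : ℕ → Idx}
    (hl : ιs.length = γs.length) (h : ∀ p ∈ ιs.zip γs, HasSort Θ' p.1 p.2)
    (hσ : SortSub Θ Θ' σ) : SortSub (γs ++ Θ) Θ' (scons ιs σ) := by
  intro i γ hi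
  rcases lt_or_ge i γs.length with hl' | hl'
  · rw [List.getElem?_append_left hl', List.getElem?_eq_getElem hl'] at hi
    cases hi
    have hi' : i < ιs.length := hl ▸ hl'
    rw [scons, List.getElem?_eq_getElem hi']
    exact h (ιs[i], γs[i]) (List.mem_iff_getElem.mpr ⟨i, by simpa using ⟨hi', hl'⟩, by simp⟩)
  · rw [List.getElem?_append_right hl'] at hi
    rw [scons, List.getElem?_eq_none (hl ▸ hl'), hl]
    exact hσ _ _ hi

/-- A closed shape denotes the same sequence for all values of variables. -/
theorem HasSort.evalDim_closed {ι : Idx} {γ : Srt} (h : HasSort [] ι γ) (d d' : ℕ → ℕ) :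
    ι.evalDim d = ι.evalDim d' := by
  generalize hΘ : ([] : List Srt) = Θ at h
  induction h with
  | var h => subst hΘ; simp at h
  | nat | shp | app => simp [Idx.evalDim]
  | add _ ih =>
    simp only [Idx.evalDim, Idx.evalDimL_eq_map]
    exact congrArg List.sum (List.map_congr_left ih)

theorem HasSort.evalShape_closed {ι : Idx} {γ : Srt} (h : HasSort [] ι γ) (d d' : ℕ → ℕ)
    (s s' : ℕ → List ℕ) : ι.evalShape d s = ι.evalShape d' s' := by
  generalize hΘ : ([] : List Srt) = Θ at h
  induction h with
  | var h => subst hΘ; simp at h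
  | nat | add => simp [Idx.evalShape]
  | shp h =>
    subst hΘ
    simp only [Idx.evalShape, Idx.evalDimL_eq_map]
    exact List.map_congr_left fun ι hι => (h ι hι).evalDim_closed d d'
  | app _ ih =>
    simp only [Idx.evalShape, Idx.evalShapeL_eq_flatMap]
    exact List.flatMap_congr ih

/-! ## Equality of shapes -/

theorem IdxEqv.symm {Θ : List Srt} {ι ι' : Idx} (h : IdxEqv Θ ι ι') : IdxEqv Θ ι' ι :=
  ⟨h.2.1, h.1, fun d s => (h.2.2 d s).symm⟩

theorem IdxEqv.trans {Θ : List Srt} {ι ι' ι'' : Idx} (h : IdxEqv Θ ι ι') (h' : IdxEqv Θ ι' ι'') :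
    IdxEqv Θ ι ι'' :=
  ⟨h.1, h'.2.1, fun d s => (h.2.2 d s).trans (h'.2.2 d s)⟩

theorem IdxEqv.subst {Θ Θ' : List Srt} {σ : ℕ → Idx} (hσ : SortSub Θ Θ' σ) {ι ι' : Idx}
    (h : IdxEqv Θ ι ι') : IdxEqv Θ' (ι.subst σ) (ι'.subst σ) :=
  ⟨h.1.subst hσ, h.2.1.subst hσ, fun d s => by simp only [Idx.evalShape_subst, h.2.2]⟩

theorem IsMax.subst {Θ Θ' : List Srt} {σ : ℕ → Idx} (hσ : SortSub Θ Θ' σ) {ιp : Idx}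
    {l : List Idx} (h : IsMax Θ ιp l) : IsMax Θ' (ιp.subst σ) (l.map (Idx.subst σ)) := by
  refine ⟨List.mem_map_of_mem h.1, ?_⟩
  simp only [List.mem_map]
  rintro _ ⟨ι, hι, rfl⟩
  obtain ⟨w, hw⟩ := h.2 ι hι
  exact ⟨w.subst σ, by simpa [Idx.subst] using hw.subst hσ⟩

/-- The sequence denoted by a closed shape. -/
def Idx.val (ι : Idx) : List ℕ := ι.evalShape (fun _ => 0) fun _ => []

@[simp] theorem Idx.val_lit (ns : List ℕ) : (Idx.lit ns).val = ns := by simp [Idx.val]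

@[simp] theorem Idx.val_app (ι ι' : Idx) : (Idx.app [ι, ι']).val = ι.val ++ ι'.val := by
  simp [Idx.val, Idx.evalShape]

/-- A closed shape does not depend on the valuation, so a single valuation decides equality. -/
theorem idxEqv_nil_iff {ι ι' : Idx} :
    IdxEqv [] ι ι' ↔ HasSort [] ι .shape ∧ HasSort [] ι' .shape ∧ ι.val = ι'.val := by
  constructor
  · exact fun h => ⟨h.1, h.2.1, h.2.2 _ _⟩
  · refine fun h => ⟨h.1, h.2.1, fun d s => ?_⟩
    rw [h.1.evalShape_closed d _ s, h.2.1.evalShape_closed d _ s]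
    exact h.2.2

theorem prefix_nil {ι ι' : Idx} (h : Prefix [] ι ι') : ι.val <+: ι'.val := by
  obtain ⟨w, hw⟩ := h
  exact ⟨w.val, by simpa using (idxEqv_nil_iff.mp hw).2.2⟩

/-! ## Kinding -/

section Kinding

variable {B : Type u}

/-- The type substitution `θ` respects kinds. -/
def KindSub (Θ' : List Srt) (Δ Δ' : List Knd) (θ : ℕ → Ty B) : Prop :=
  ∀ i k, Δ[i]? = some k → HasKind Θ' Δ' (θ i) k

/-- Renaming precedes substitution because pushing a type substitution under a binder shifts its
values, and the shifted values must keep their kinds. -/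
theorem HasKind.rename {Θ Θ' : List Srt} {Δ Δ' : List Knd} {f g : ℕ → ℕ} (hf : Ren Θ Θ' f)
    (hg : Ren Δ Δ' g) {τ : Ty B} {k : Knd} (h : HasKind Θ Δ τ k) :
    HasKind Θ' Δ' (τ.rename f g) k := by
  induction h generalizing Θ' Δ' f g with
  | var h => exact .var (hg _ _ h)
  | base b => exact .base b
  | fn _ _ ih ih' =>
    rw [Ty.rename, Ty.renameL_eq_map]
    refine .fn ?_ (ih' hf hg)
    simp only [List.mem_map]
    rintro _ ⟨τ, hτ, rfl⟩
    exact ih τ hτ hf hg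
  | all _ ih => exact .all (ih hf (hg.lift _))
  | pi _ ih => exact .pi (ih (hf.lift _) hg)
  | sigma _ ih => exact .sigma (ih (hf.lift _) hg)
  | arr _ h ih =>
    exact .arr (ih hf hg) (by rw [Idx.rename_eq_subst]; exact h.subst hf.sortSub)

theorem HasKind.shiftI {Θ : List Srt} {Δ : List Knd} {τ : Ty B} {k : Knd}
    (h : HasKind Θ Δ τ k) (γs : List Srt) : HasKind (γs ++ Θ) Δ (τ.shiftI γs.length) k :=
  h.rename (ren_add Θ γs) (ren_id Δ)

theorem HasKind.shiftT {Θ : List Srt} {Δ : List Knd} {τ : Ty B} {k : Knd}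
    (h : HasKind Θ Δ τ k) (ks : List Knd) : HasKind Θ (ks ++ Δ) (τ.shiftT ks.length) k :=
  h.rename (ren_id Θ) (ren_add Δ ks)

theorem KindSub.shiftI {Θ' : List Srt} {Δ Δ' : List Knd} {θ : ℕ → Ty B}
    (h : KindSub Θ' Δ Δ' θ) (γs : List Srt) :
    KindSub (γs ++ Θ') Δ Δ' fun i => (θ i).shiftI γs.length :=
  fun i k hi => (h i k hi).shiftI γs

theorem KindSub.up {Θ' : List Srt} {Δ Δ' : List Knd} {θ : ℕ → Ty B}
    (h : KindSub Θ' Δ Δ' θ) (ks : List Knd) :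
    KindSub Θ' (ks ++ Δ) (ks ++ Δ') (Ty.up ks.length θ) := by
  intro i k hi
  rcases lt_or_ge i ks.length with hl | hl
  · rw [Ty.up, if_pos hl]
    rw [List.getElem?_append_left hl] at hi
    exact .var (by rwa [List.getElem?_append_left hl])
  · rw [List.getElem?_append_right hl] at hi
    rw [Ty.up, if_neg (not_lt.mpr hl)]
    exact (h _ _ hi).shiftT ks

theorem kindSub_var (Θ : List Srt) (Δ : List Knd) : KindSub (B := B) Θ Δ Δ .var :=
  fun _ _ h => .var h

theorem kindSub_scons {Θ' : List Srt} {Δ Δ' ks : List Knd} {τs : List (Ty B)} {θ : ℕ → Ty B}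
    (hl : τs.length = ks.length) (h : ∀ p ∈ τs.zip ks, HasKind Θ' Δ' p.1 p.2)
    (hθ : KindSub Θ' Δ Δ' θ) : KindSub Θ' (ks ++ Δ) Δ' (scons τs θ) := by
  intro i k hi
  rcases lt_or_ge i ks.length with hl' | hl'
  · rw [List.getElem?_append_left hl', List.getElem?_eq_getElem hl'] at hi
    cases hi
    have hi' : i < τs.length := hl ▸ hl'
    rw [scons, List.getElem?_eq_getElem hi']
    exact h (τs[i], ks[i]) (List.mem_iff_getElem.mpr ⟨i, by simpa using ⟨hi', hl'⟩, by simp⟩)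
  · rw [List.getElem?_append_right hl'] at hi
    rw [scons, List.getElem?_eq_none (hl ▸ hl'), hl]
    exact hθ _ _ hi

theorem HasKind.subst {Θ Θ' : List Srt} {Δ Δ' : List Knd} {σ : ℕ → Idx} {θ : ℕ → Ty B}
    (hσ : SortSub Θ Θ' σ) (hθ : KindSub Θ' Δ Δ' θ) {τ : Ty B} {k : Knd}
    (h : HasKind Θ Δ τ k) : HasKind Θ' Δ' (τ.subst σ θ) k := by
  induction h generalizing Θ' Δ' σ θ with
  | var h => exact hθ _ _ h
  | base b => exact .base b
  | fn _ _ ih ih' =>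
    rw [Ty.subst, Ty.substL_eq_map]
    refine .fn ?_ (ih' hσ hθ)
    simp only [List.mem_map]
    rintro _ ⟨τ, hτ, rfl⟩
    exact ih τ hτ hσ hθ
  | all _ ih => exact .all (ih hσ (hθ.up _))
  | pi _ ih => exact .pi (ih (hσ.up _) (hθ.shiftI _))
  | sigma _ ih => exact .sigma (ih (hσ.up _) (hθ.shiftI _))
  | arr _ h ih => exact .arr (ih hσ hθ) (h.subst hσ)

theorem HasKind.instT {Θ : List Srt} {Δ ks : List Knd} {τs : List (Ty B)} {τ : Ty B} {k : Knd}
    (h : HasKind Θ (ks ++ Δ) τ k) (hl : τs.length = ks.length)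
    (hτs : ∀ p ∈ τs.zip ks, HasKind Θ Δ p.1 p.2) : HasKind Θ Δ (τ.instT τs) k :=
  h.subst (sortSub_var Θ) (kindSub_scons hl hτs (kindSub_var Θ Δ))

theorem HasKind.instI {Θ γs : List Srt} {Δ : List Knd} {ιs : List Idx} {τ : Ty B} {k : Knd}
    (h : HasKind (γs ++ Θ) Δ τ k) (hl : ιs.length = γs.length)
    (hιs : ∀ p ∈ ιs.zip γs, HasSort Θ p.1 p.2) : HasKind Θ Δ (τ.instI ιs) k :=
  h.subst (sortSub_scons hl hιs (sortSub_var Θ)) (kindSub_var Θ Δ)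

/-- A substitution that fixes the variables of the environment does not affect an index. -/
theorem HasSort.subst_eq_self {Θ : List Srt} {σ : ℕ → Idx} (hσ : ∀ i < Θ.length, σ i = .var i)
    {ι : Idx} {γ : Srt} (h : HasSort Θ ι γ) : ι.subst σ = ι := by
  induction h with
  | var h => exact hσ _ (List.getElem?_eq_some_iff.mp h).1
  | nat => rfl
  | shp _ ih | add _ ih | app _ ih =>
    rw [Idx.subst, Idx.substL_eq_map, List.map_congr_left ih, List.map_id']

/-- Needed for operators: their types are closed, so substitution into a term leaves these types
alone. The induction passes under binders, where more variables have to be fixed, hence the general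
environments. -/
theorem HasKind.subst_eq_self {Θ : List Srt} {Δ : List Knd} {σ : ℕ → Idx} {θ : ℕ → Ty B}
    (hσ : ∀ i < Θ.length, σ i = .var i) (hθ : ∀ i < Δ.length, θ i = .var i) {τ : Ty B} {k : Knd}
    (h : HasKind Θ Δ τ k) : τ.subst σ θ = τ := by
  have keyσ : ∀ (Θ γs : List Srt) (σ : ℕ → Idx), (∀ i < Θ.length, σ i = .var i) →
      ∀ i < (γs ++ Θ).length, Idx.up γs.length σ i = .var i := by
    intro Θ γs σ hσ i hi
    simp only [List.length_append] at hi
    simp only [Idx.up]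
    split
    · rfl
    · rw [hσ _ (by omega), Idx.rename]; congr 1; omega
  induction h generalizing σ θ with
  | var h => exact hθ _ (List.getElem?_eq_some_iff.mp h).1
  | base b => rfl
  | fn _ _ ih ih' =>
    rw [Ty.subst, Ty.substL_eq_map, ih' hσ hθ, List.map_congr_left fun τ hτ => ih τ hτ hσ hθ,
      List.map_id']
  | @all Θ Δ ks _ _ ih =>
    rw [Ty.subst, ih hσ]
    intro i hi
    simp only [List.length_append] at hi
    simp only [Ty.up]
    split
    · rfl
    · rw [hθ _ (by omega), Ty.shiftT, Ty.rename]; congr 1; omega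
  | pi _ ih | sigma _ ih =>
    rw [Ty.subst, ih (keyσ _ _ _ hσ) fun i hi => by rw [hθ i hi, Ty.shiftI_var]]
  | arr _ h ih => rw [Ty.subst, ih hσ hθ, h.subst_eq_self hσ]

theorem HasKind.weaken {τ : Ty B} {k : Knd} (h : HasKind [] [] τ k) (Θ : List Srt)
    (Δ : List Knd) : HasKind Θ Δ τ k := by
  have := h.subst (Θ' := Θ) (Δ' := Δ) (σ := .var) (θ := .var)
    (fun i γ hi => by simp at hi) (fun i γ hi => by simp at hi)
  rwa [Ty.subst_var] at this

end Kinding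

/-! ## Type equivalence -/

section TypeEquivalence

variable {B : Type u}

theorem TEqv.symm {Θ : List Srt} {τ τ' : Ty B} (h : TEqv Θ τ τ') : TEqv Θ τ' τ := by
  induction h with
  | refl τ => exact .refl τ
  | arr _ h ih => exact .arr ih h.symm
  | fn hl _ _ ih ih' =>
    refine .fn hl.symm (fun p hp => ?_) ih'
    exact ih p.swap (by rw [← List.zip_swap, List.mem_map]; exact ⟨p, hp, rfl⟩)
  | all _ ih => exact .all ih
  | pi _ ih => exact .pi ih
  | sigma _ ih => exact .sigma ih

theorem tEqv_zip_iff {Θ : List Srt} {l l' : List (Ty B)} (hl : l.length = l'.length) :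
    (∀ p ∈ l.zip l', TEqv Θ p.1 p.2) ↔ List.Forall₂ (TEqv Θ) l l' := by
  simp [List.forall₂_iff_zip, hl]

/-- The disjunction is unavoidable: reflexivity also applies to ill-sorted shapes, for which
`IdxEqv` fails. -/
theorem TEqv.arr_inv {Θ : List Srt} {τ : Ty B} {ι : Idx} {τ' : Ty B}
    (h : TEqv Θ (.arr τ ι) τ') : ∃ τ₁ ι₁, τ' = .arr τ₁ ι₁ ∧ TEqv Θ τ τ₁ ∧
      (ι = ι₁ ∨ IdxEqv Θ ι ι₁) := by
  cases h with
  | refl => exact ⟨_, _, rfl, .refl _, .inl rfl⟩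
  | arr h h' => exact ⟨_, _, rfl, h, .inr h'⟩

theorem TEqv.fn_inv {Θ : List Srt} {ins : List (Ty B)} {out τ' : Ty B}
    (h : TEqv Θ (.fn ins out) τ') : ∃ ins' out', τ' = .fn ins' out' ∧
      List.Forall₂ (TEqv Θ) ins ins' ∧ TEqv Θ out out' := by
  cases h with
  | refl => exact ⟨_, _, rfl, List.forall₂_same.mpr fun τ _ => .refl τ, .refl _⟩
  | fn hl h h' => exact ⟨_, _, rfl, (tEqv_zip_iff hl).mp h, h'⟩

theorem TEqv.all_inv {Θ : List Srt} {ks : List Knd} {τ τ' : Ty B}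
    (h : TEqv Θ (.all ks τ) τ') : ∃ τ₁, τ' = .all ks τ₁ ∧ TEqv Θ τ τ₁ := by
  cases h with
  | refl => exact ⟨_, rfl, .refl _⟩
  | all h => exact ⟨_, rfl, h⟩

theorem TEqv.pi_inv {Θ γs : List Srt} {τ τ' : Ty B}
    (h : TEqv Θ (.pi γs τ) τ') : ∃ τ₁, τ' = .pi γs τ₁ ∧ TEqv (γs ++ Θ) τ τ₁ := by
  cases h with
  | refl => exact ⟨_, rfl, .refl _⟩
  | pi h => exact ⟨_, rfl, h⟩

theorem TEqv.sigma_inv {Θ γs : List Srt} {τ τ' : Ty B}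
    (h : TEqv Θ (.sigma γs τ) τ') : ∃ τ₁, τ' = .sigma γs τ₁ ∧ TEqv (γs ++ Θ) τ τ₁ := by
  cases h with
  | refl => exact ⟨_, rfl, .refl _⟩
  | sigma h => exact ⟨_, rfl, h⟩

/-- Transitivity is admissible because equivalent types share their outermost constructor and binder
list: the second equivalence is inverted along the structure of the first. -/
theorem TEqv.trans {Θ : List Srt} {τ τ' τ'' : Ty B} (h : TEqv Θ τ τ') (h' : TEqv Θ τ' τ'') :
    TEqv Θ τ τ'' := by
  induction h generalizing τ'' with
  | refl τ => exact h'
  | arr h₁ h₂ ih =>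
    obtain ⟨τ₁, ι₁, rfl, h, rfl | hι⟩ := h'.arr_inv
    · exact .arr (ih h) h₂
    · exact .arr (ih h) (h₂.trans hι)
  | @fn Θ ins ins' out out' hl h₁ h₂ ih ih' =>
    obtain ⟨ins₁, out₁, rfl, h, ho⟩ := h'.fn_inv
    have hl' := h.length_eq
    refine .fn (hl.trans hl') (fun p hp => ?_) (ih' ho)
    obtain ⟨i, hi, rfl⟩ := List.mem_iff_getElem.mp hp
    simp only [List.length_zip, lt_inf_iff] at hi
    rw [List.getElem_zip]
    have hi' : i < ins'.length := by omega
    exact ih (ins[i], ins'[i]) (List.mem_iff_getElem.mpr ⟨i, by simp; omega, by simp⟩)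
      (h.get hi' hi.2)
  | all _ ih =>
    obtain ⟨τ₁, rfl, h⟩ := h'.all_inv
    exact .all (ih h)
  | pi _ ih =>
    obtain ⟨τ₁, rfl, h⟩ := h'.pi_inv
    exact .pi (ih h)
  | sigma _ ih =>
    obtain ⟨τ₁, rfl, h⟩ := h'.sigma_inv
    exact .sigma (ih h)

/-- No condition on `θ` is required: a type variable is equivalent only to itself, and reflexivity
holds for any type put in its place. -/
theorem TEqv.subst {Θ Θ' : List Srt} {σ : ℕ → Idx} (hσ : SortSub Θ Θ' σ) {τ τ' : Ty B}
    (h : TEqv Θ τ τ') (θ : ℕ → Ty B) : TEqv Θ' (τ.subst σ θ) (τ'.subst σ θ) := by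
  induction h generalizing Θ' σ θ with
  | refl τ => exact .refl _
  | arr _ h ih => exact .arr (ih hσ θ) (h.subst hσ)
  | fn hl _ _ ih ih' =>
    rw [Ty.subst, Ty.subst, Ty.substL_eq_map, Ty.substL_eq_map]
    refine .fn (by simpa using hl) ?_ (ih' hσ θ)
    rw [List.zip_map]
    simp only [List.mem_map]
    rintro _ ⟨p, hp, rfl⟩
    exact ih p hp hσ θ
  | all _ ih => exact .all (ih hσ _)
  | pi _ ih => exact .pi (ih (hσ.up _) _)
  | sigma _ ih => exact .sigma (ih (hσ.up _) _)

/-- Kinds survive conversion because equality of shapes carries the well-sortedness of both sides.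
-/
theorem HasKind.eqv {Θ : List Srt} {τ τ' : Ty B} (h : TEqv Θ τ τ') {Δ : List Knd} {k : Knd}
    (hk : HasKind Θ Δ τ k) : HasKind Θ Δ τ' k := by
  induction h generalizing Δ k with
  | refl τ => exact hk
  | arr _ h ih => cases hk with | arr h' _ => exact .arr (ih h') h.2.1
  | @fn Θ ins ins' out out' hl h₁ h₂ ih ih' =>
    cases hk with
    | fn ha hb =>
      refine .fn (fun τ hτ => ?_) (ih' hb)
      obtain ⟨i, hi, rfl⟩ := List.mem_iff_getElem.mp hτ
      exact ih (ins[i], ins'[i]) (List.mem_iff_getElem.mpr ⟨i, by simp; omega, by simp⟩)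
        (ha _ (List.getElem_mem _))
  | all _ ih => cases hk with | all h => exact .all (ih h)
  | pi _ ih => cases hk with | pi h => exact .pi (ih h)
  | sigma _ ih => cases hk with | sigma h => exact .sigma (ih h)

end TypeEquivalence

/-! ## Renaming in typing derivations -/

theorem forall_mem_zip_map_left {α β γ : Type*} {l : List α} {l' : List β} {f : α → γ}
    {P : γ × β → Prop} (h : ∀ p ∈ l.zip l', P (f p.1, p.2)) : ∀ p ∈ (l.map f).zip l', P p := by
  rw [List.zip_map_left]
  simp only [List.mem_map]
  rintro _ ⟨p, hp, rfl⟩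
  exact h p hp

theorem Idx.rename_lit (f : ℕ → ℕ) (ns : List ℕ) : (lit ns).rename f = lit ns := by
  rw [rename_eq_subst, subst_lit]

theorem Idx.inst_rename (ιs : List Idx) (n : ℕ) (h : ιs.length = n) (f : ℕ → ℕ) (ι : Idx) :
    (ι.subst (scons ιs var)).rename f =
      (ι.rename (liftR n f)).subst (scons (ιs.map (rename f)) var) := by
  have : rename f = subst fun i => var (f i) := funext (rename_eq_subst f)
  rw [this, inst_subst ιs n h, rename_eq_subst, up_var]

theorem HasSort.rename {Θ Θ' : List Srt} {f : ℕ → ℕ} (hf : Ren Θ Θ' f) {ι : Idx} {γ : Srt}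
    (h : HasSort Θ ι γ) : HasSort Θ' (ι.rename f) γ :=
  Idx.rename_eq_subst f ι ▸ h.subst hf.sortSub

theorem IsMax.rename {Θ Θ' : List Srt} {f : ℕ → ℕ} (hf : Ren Θ Θ' f) {ιp : Idx}
    {l : List Idx} (h : IsMax Θ ιp l) : IsMax Θ' (ιp.rename f) (l.map (Idx.rename f)) := by
  have : Idx.rename f = Idx.subst fun i => .var (f i) := funext (Idx.rename_eq_subst f)
  rw [this]
  exact h.subst hf.sortSub

namespace Ty

variable {B : Type u}

theorem shiftI_rename (n : ℕ) (f g : ℕ → ℕ) (τ : Ty B) :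
    (τ.shiftI n).rename (liftR n f) g = (τ.rename f g).shiftI n := by
  simp [shiftI, rename_rename, liftR_add]

theorem shiftT_rename (n : ℕ) (f g : ℕ → ℕ) (τ : Ty B) :
    (τ.shiftT n).rename f (liftR n g) = (τ.rename f g).shiftT n := by
  simp [shiftT, rename_rename, liftR_add]

theorem instT_rename (τs : List (Ty B)) (n : ℕ) (h : τs.length = n) (f g : ℕ → ℕ) (τ : Ty B) :
    (τ.instT τs).rename f g = (τ.rename f (liftR n g)).instT (τs.map (rename f g)) := by
  have : rename f g = subst (B := B) (fun i => .var (f i)) fun i => .var (g i) :=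
    funext (rename_eq_subst f g)
  rw [this, instT_subst τs n h, rename_eq_subst, up_var]

theorem instI_rename (ιs : List Idx) (n : ℕ) (h : ιs.length = n) (f g : ℕ → ℕ) (τ : Ty B) :
    (τ.instI ιs).rename f g = (τ.rename (liftR n f) g).instI (ιs.map (Idx.rename f)) := by
  have : Idx.rename f = Idx.subst fun i => .var (f i) := funext (Idx.rename_eq_subst f)
  rw [this, rename_eq_subst, instI_subst ιs n h, rename_eq_subst, Idx.up_var]
  rfl

end Ty

theorem TEqv.rename {B : Type u} {Θ Θ' : List Srt} {f : ℕ → ℕ} (hf : Ren Θ Θ' f) {τ τ' : Ty B}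
    (h : TEqv Θ τ τ') (g : ℕ → ℕ) : TEqv Θ' (τ.rename f g) (τ'.rename f g) := by
  rw [Ty.rename_eq_subst, Ty.rename_eq_subst]
  exact h.subst hf.sortSub _

theorem HasKind.rename_eq_self {B : Type u} {τ : Ty B} {k : Knd} (h : HasKind [] [] τ k)
    (f g : ℕ → ℕ) : τ.rename f g = τ := by
  rw [Ty.rename_eq_subst]
  exact h.subst_eq_self (by simp) (by simp)

variable {S : Signature.{u}}

@[simp] theorem Expr.renameL_eq_map (f g h : ℕ → ℕ) (l : List (Expr S)) :
    Expr.renameL f g h l = l.map (Expr.rename f g h) := by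
  induction l <;> simp_all [Expr.renameL]

@[simp] theorem Atom.renameL_eq_map (f g h : ℕ → ℕ) (l : List (Atom S)) :
    Atom.renameL f g h l = l.map (Atom.rename f g h) := by
  induction l <;> simp_all [Atom.renameL]

@[simp] theorem Expr.substL_eq_map (σ : ℕ → Idx) (θ : ℕ → Ty S.Base) (ρ : ℕ → Expr S)
    (l : List (Expr S)) : Expr.substL σ θ ρ l = l.map (Expr.subst σ θ ρ) := by
  induction l <;> simp_all [Expr.substL]

@[simp] theorem Atom.substL_eq_map (σ : ℕ → Idx) (θ : ℕ → Ty S.Base) (ρ : ℕ → Expr S)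
    (l : List (Atom S)) : Atom.substL σ θ ρ l = l.map (Atom.subst σ θ ρ) := by
  induction l <;> simp_all [Atom.substL]

-- Type and index abstractions are typable only over values, so values must be stable under renaming
-- and, below, under substitution. They are, because the head of a value is an array literal and
-- never a variable.
mutual
theorem IsVal.rename {e : Expr S} (h : IsVal e) (f g k : ℕ → ℕ) : IsVal (e.rename f g k) := by
  cases h with
  | array h =>
    rw [Expr.rename, Atom.renameL_eq_map]
    refine .array fun a ha => ?_
    obtain ⟨a, ha', rfl⟩ := List.mem_map.mp ha
    exact (h a ha').rename f g k
theorem IsAtomVal.rename {a : Atom S} (h : IsAtomVal a) (f g k : ℕ → ℕ) :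
    IsAtomVal (a.rename f g k) := by
  cases h with
  | const c => exact .const c
  | op o => exact .op o
  | lam => exact .lam _ _
  | tlam h => exact .tlam (h.rename _ _ _)
  | ilam h => exact .ilam (h.rename _ _ _)
  | box h => exact .box (h.rename _ _ _)
end

mutual
theorem IsVal.subst {e : Expr S} (h : IsVal e) (σ : ℕ → Idx) (θ : ℕ → Ty S.Base)
    (ρ : ℕ → Expr S) : IsVal (e.subst σ θ ρ) := by
  cases h with
  | array h =>
    rw [Expr.subst, Atom.substL_eq_map]
    refine .array fun a ha => ?_
    obtain ⟨a, ha', rfl⟩ := List.mem_map.mp ha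
    exact (h a ha').subst σ θ ρ
theorem IsAtomVal.subst {a : Atom S} (h : IsAtomVal a) (σ : ℕ → Idx) (θ : ℕ → Ty S.Base)
    (ρ : ℕ → Expr S) : IsAtomVal (a.subst σ θ ρ) := by
  cases h with
  | const c => exact .const c
  | op o => exact .op o
  | lam => exact .lam _ _
  | tlam h => exact .tlam (h.subst _ _ _)
  | ilam h => exact .ilam (h.subst _ _ _)
  | box h => exact .box (h.subst _ _ _)
end

-- This is weakening for all three environments at once. It comes before the substitution lemma,
-- which shifts the substituted terms whenever it passes a binder.
mutual
theorem HasType.rename {Θ : List Srt} {Δ : List Knd} {Γ : List (Ty S.Base)} {e : Expr S}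
    {τ : Ty S.Base} (h : HasType Θ Δ Γ e τ) {Θ' : List Srt} {Δ' : List Knd}
    {Γ' : List (Ty S.Base)} {f g k : ℕ → ℕ} (hf : Ren Θ Θ' f) (hg : Ren Δ Δ' g)
    (hk : Ren (Γ.map (Ty.rename f g)) Γ' k) :
    HasType Θ' Δ' Γ' (e.rename f g k) (τ.rename f g) := by
  match h with
  | .eqv h h' => exact .eqv (h.rename hf hg hk) (h'.rename hf g)
  | .var h => exact .var (hk _ _ (by simp [h]))
  | .array h₁ h₂ h₃ h₄ =>
    have h₄ := h₄.rename hf g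
    simp only [Expr.rename, Ty.rename, Idx.rename_lit, Atom.renameL_eq_map] at h₄ ⊢
    refine .array (fun a ha => ?_) (h₂.rename hf hg) (by simpa using h₃) h₄
    obtain ⟨a, ha', rfl⟩ := List.mem_map.mp ha
    exact (h₁ a ha').rename hf hg hk
  | .frame h₁ h₂ h₃ h₄ =>
    have h₄ := h₄.rename hf g
    simp only [Expr.rename, Ty.rename, Idx.rename, Idx.renameL, Idx.rename_lit,
      Expr.renameL_eq_map] at h₄ ⊢
    refine .frame (fun e he => ?_) (h₂.rename hf hg) (by simpa using h₃) h₄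
    obtain ⟨e, he', rfl⟩ := List.mem_map.mp he
    exact (h₁ e he').rename hf hg hk
  | @HasType.app _ _ _ _ _ es cells frames τo _ ιf ιo ιp h₁ h₂ h₃ h₄ h₅ h₆ =>
    have h₆ := h₆.rename hf g
    have h₁ := h₁.rename hf hg hk
    simp only [Expr.rename, Ty.rename, Ty.renameL_eq_map, Idx.rename, Idx.renameL,
      Expr.renameL_eq_map, List.map_map, Function.comp_def] at h₁ h₆ ⊢
    refine .app (cells := cells.map fun c => (c.1.rename f g, c.2.rename f))
      (frames := frames.map (Idx.rename f)) ?_ (by simpa using h₂) (by simpa using h₃)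
      (fun i e c ι he hc hι => ?_) (h₅.rename hf) h₆
    · simpa only [List.map_map, Function.comp_def] using h₁
    · simp only [List.getElem?_map, Option.map_eq_some_iff] at he hc hι
      obtain ⟨e, he, rfl⟩ := he
      obtain ⟨c, hc, rfl⟩ := hc
      obtain ⟨ι, hι, rfl⟩ := hι
      exact (h₄ i e c ι he hc hι).rename hf hg hk
  | .tapp h₁ h₂ h₃ h₄ =>
    have h₄ := h₄.rename hf g
    have h₁ := h₁.rename hf hg hk
    simp only [Expr.rename, Ty.rename, Idx.rename, Idx.renameL,
      Ty.instT_rename _ _ h₂] at h₁ h₄ ⊢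
    exact .tapp h₁ (by simpa using h₂) (forall_mem_zip_map_left fun p hp => (h₃ p hp).rename hf hg)
      h₄
  | .iapp h₁ h₂ h₃ h₄ =>
    have h₄ := h₄.rename hf g
    have h₁ := h₁.rename hf hg hk
    simp only [Expr.rename, Ty.rename, Idx.rename, Idx.renameL,
      Ty.instI_rename _ _ h₂, Idx.inst_rename _ _ h₂] at h₁ h₄ ⊢
    exact .iapp h₁ (by simpa using h₂) (forall_mem_zip_map_left fun p hp => (h₃ p hp).rename hf)
      h₄
  | @HasType.unbox _ _ _ _ _ _ _ γs τ' _ _ _ _ h₁ rfl h₃ h₄ h₅ =>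
    have h₅ := h₅.rename hf g
    have h₁ := h₁.rename hf hg hk
    simp only [Expr.rename, Ty.rename, Idx.rename, Idx.renameL] at h₁ h₅ ⊢
    refine .unbox h₁ rfl ?_ (h₄.rename hf hg) h₅
    -- The body of `unbox` lives under index variables and one term variable: the context is shifted
    -- first and then extended by the type of the content, which already mentions the new indices.
    have hk' := (hk.map (Ty.shiftI γs.length)).lift [τ'.rename (liftR γs.length f) g]
    have := h₃.rename (hf.lift γs) hg (by
      simpa [Function.comp_def, Ty.shiftI_rename] using hk')
    rwa [Ty.shiftI_rename] at this
termination_by structural h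
theorem HasAtomType.rename {Θ : List Srt} {Δ : List Knd} {Γ : List (Ty S.Base)} {a : Atom S}
    {τ : Ty S.Base} (h : HasAtomType Θ Δ Γ a τ) {Θ' : List Srt} {Δ' : List Knd}
    {Γ' : List (Ty S.Base)} {f g k : ℕ → ℕ} (hf : Ren Θ Θ' f) (hg : Ren Δ Δ' g)
    (hk : Ren (Γ.map (Ty.rename f g)) Γ' k) :
    HasAtomType Θ' Δ' Γ' (a.rename f g k) (τ.rename f g) := by
  match h with
  | .eqv h h' => exact .eqv (h.rename hf hg hk) (h'.rename hf g)
  | .const c => exact .const c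
  | .op o => rw [(S.op_wf o).rename_eq_self]; exact .op o
  | .lam h₁ h₂ =>
    rw [Atom.rename, Ty.rename, Ty.renameL_eq_map]
    refine .lam (fun τ hτ => ?_) (h₂.rename hf hg ?_)
    · obtain ⟨τ, hτ', rfl⟩ := List.mem_map.mp hτ
      exact (h₁ τ hτ').rename hf hg
    · have := hk.lift (List.map (Ty.rename f g) ‹_›)
      simpa using this
  | @HasAtomType.tlam _ _ _ _ ks _ _ h₁ h₂ =>
    refine .tlam (h₁.rename _ _ _) (h₂.rename hf (hg.lift _) ?_)
    have := hk.map (Ty.shiftT ks.length)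
    simpa [Function.comp_def, Ty.shiftT_rename] using this
  | @HasAtomType.ilam _ _ _ _ γs _ _ h₁ h₂ =>
    refine .ilam (h₁.rename _ _ _) (h₂.rename (hf.lift _) hg ?_)
    have := hk.map (Ty.shiftI γs.length)
    simpa [Function.comp_def, Ty.shiftI_rename] using this
  | .box h₁ h₂ h₃ h₄ =>
    have h₄ := h₄.rename hf hg hk
    rw [Ty.instI_rename _ _ h₂] at h₄
    exact .box (h₁.rename hf hg) (by simpa using h₂)
      (forall_mem_zip_map_left fun p hp => (h₃ p hp).rename hf) h₄
termination_by structural h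
end

/-! ## Substitution in typing derivations -/

/-- The term substitution `ρ` respects types. -/
def TermSub (Θ' : List Srt) (Δ' : List Knd) (Γ' : List (Ty S.Base)) (σ : ℕ → Idx)
    (θ : ℕ → Ty S.Base) (ρ : ℕ → Expr S) (Γ : List (Ty S.Base)) : Prop :=
  ∀ x τ, Γ[x]? = some τ → HasType Θ' Δ' Γ' (ρ x) (τ.subst σ θ)

section TermSub

variable {Θ' : List Srt} {Δ' : List Knd} {Γ Γ' : List (Ty S.Base)} {σ : ℕ → Idx}
  {θ : ℕ → Ty S.Base} {ρ : ℕ → Expr S}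

theorem TermSub.upI (h : TermSub Θ' Δ' Γ' σ θ ρ Γ) (γs : List Srt) :
    TermSub (γs ++ Θ') Δ' (Γ'.map (Ty.shiftI γs.length)) (Idx.up γs.length σ)
      (fun i => (θ i).shiftI γs.length) (Expr.upI γs.length ρ)
      (Γ.map (Ty.shiftI γs.length)) := by
  intro x τ hx
  simp only [List.getElem?_map, Option.map_eq_some_iff] at hx
  obtain ⟨τ, hx, rfl⟩ := hx
  rw [Ty.shiftI_subst_up]
  exact (h x τ hx).rename (ren_add Θ' γs) (ren_id Δ') (ren_id _)

theorem TermSub.upT (h : TermSub Θ' Δ' Γ' σ θ ρ Γ) (ks : List Knd) :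
    TermSub Θ' (ks ++ Δ') (Γ'.map (Ty.shiftT ks.length)) σ (Ty.up ks.length θ)
      (Expr.upT ks.length ρ) (Γ.map (Ty.shiftT ks.length)) := by
  intro x τ hx
  simp only [List.getElem?_map, Option.map_eq_some_iff] at hx
  obtain ⟨τ, hx, rfl⟩ := hx
  rw [Ty.shiftT_subst_up]
  exact (h x τ hx).rename (ren_id Θ') (ren_add Δ' ks) (ren_id _)

theorem TermSub.up (h : TermSub Θ' Δ' Γ' σ θ ρ Γ) (M : List (Ty S.Base)) :
    TermSub Θ' Δ' (M.map (Ty.subst σ θ) ++ Γ') σ θ (Expr.up M.length ρ) (M ++ Γ) := by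
  intro x τ hx
  rcases lt_or_ge x M.length with hl | hl
  · rw [Expr.up, if_pos hl]
    rw [List.getElem?_append_left hl] at hx
    exact .var (by rw [List.getElem?_append_left (by simpa using hl)]; simp [hx])
  · rw [List.getElem?_append_right hl] at hx
    rw [Expr.up, if_neg (not_lt.mpr hl)]
    -- Only term variables are shifted, so the identity renamings in the type and in the context
    -- must be removed afterwards.
    have := (h _ _ hx).rename (ren_id Θ') (ren_id Δ')
      (Γ' := M.map (Ty.subst σ θ) ++ Γ') (k := (· + M.length)) (by
        have := ren_add Γ' (M.map (Ty.subst σ θ))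
        have hid : Γ'.map (Ty.rename id id) = Γ' := by
          rw [funext Ty.rename_id, List.map_id']
        rw [hid]
        simpa using this)
    rwa [Ty.rename_id] at this

end TermSub

-- The substitution lemma, simultaneous in indices, types and terms, so that one induction serves
-- every instantiating redex. Each binder is handled by lifting the three hypotheses.
mutual
theorem HasType.subst {Θ : List Srt} {Δ : List Knd} {Γ : List (Ty S.Base)} {e : Expr S}
    {τ : Ty S.Base} (h : HasType Θ Δ Γ e τ) {Θ' : List Srt} {Δ' : List Knd}
    {Γ' : List (Ty S.Base)} {σ : ℕ → Idx} {θ : ℕ → Ty S.Base} {ρ : ℕ → Expr S}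
    (hσ : SortSub Θ Θ' σ) (hθ : KindSub Θ' Δ Δ' θ) (hρ : TermSub Θ' Δ' Γ' σ θ ρ Γ) :
    HasType Θ' Δ' Γ' (e.subst σ θ ρ) (τ.subst σ θ) := by
  match h with
  | .eqv h h' => exact .eqv (h.subst hσ hθ hρ) (h'.subst hσ θ)
  | .var h => exact hρ _ _ h
  | .array h₁ h₂ h₃ h₄ =>
    have h₄ := h₄.subst hσ θ
    simp only [Expr.subst, Ty.subst, Idx.subst_lit, Atom.substL_eq_map] at h₄ ⊢
    refine .array (fun a ha => ?_) (h₂.subst hσ hθ) (by simpa using h₃) h₄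
    obtain ⟨a, ha', rfl⟩ := List.mem_map.mp ha
    exact (h₁ a ha').subst hσ hθ hρ
  | .frame h₁ h₂ h₃ h₄ =>
    have h₄ := h₄.subst hσ θ
    simp only [Expr.subst, Ty.subst, Idx.subst, Idx.substL, Idx.subst_lit,
      Expr.substL_eq_map] at h₄ ⊢
    refine .frame (fun e he => ?_) (h₂.subst hσ hθ) (by simpa using h₃) h₄
    obtain ⟨e, he', rfl⟩ := List.mem_map.mp he
    exact (h₁ e he').subst hσ hθ hρ
  | @HasType.app _ _ _ _ _ es cells frames τo _ ιf ιo ιp h₁ h₂ h₃ h₄ h₅ h₆ =>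
    have h₆ := h₆.subst hσ θ
    have h₁ := h₁.subst hσ hθ hρ
    simp only [Expr.subst, Ty.subst, Ty.substL_eq_map, Idx.subst, Idx.substL,
      Expr.substL_eq_map, List.map_map, Function.comp_def] at h₁ h₆ ⊢
    refine .app (cells := cells.map fun c => (c.1.subst σ θ, c.2.subst σ))
      (frames := frames.map (Idx.subst σ)) ?_ (by simpa using h₂) (by simpa using h₃)
      (fun i e c ι he hc hι => ?_) (h₅.subst hσ) h₆
    · simpa only [List.map_map, Function.comp_def] using h₁
    · simp only [List.getElem?_map, Option.map_eq_some_iff] at he hc hι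
      obtain ⟨e, he, rfl⟩ := he
      obtain ⟨c, hc, rfl⟩ := hc
      obtain ⟨ι, hι, rfl⟩ := hι
      exact (h₄ i e c ι he hc hι).subst hσ hθ hρ
  | .tapp h₁ h₂ h₃ h₄ =>
    have h₄ := h₄.subst hσ θ
    have h₁ := h₁.subst hσ hθ hρ
    simp only [Expr.subst, Ty.subst, Idx.subst, Idx.substL,
      Ty.instT_subst _ _ h₂] at h₁ h₄ ⊢
    exact .tapp h₁ (by simpa using h₂) (forall_mem_zip_map_left fun p hp => (h₃ p hp).subst hσ hθ)
      h₄
  | .iapp h₁ h₂ h₃ h₄ =>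
    have h₄ := h₄.subst hσ θ
    have h₁ := h₁.subst hσ hθ hρ
    simp only [Expr.subst, Ty.subst, Idx.subst, Idx.substL,
      Ty.instI_subst _ _ h₂, Idx.inst_subst _ _ h₂] at h₁ h₄ ⊢
    exact .iapp h₁ (by simpa using h₂) (forall_mem_zip_map_left fun p hp => (h₃ p hp).subst hσ)
      h₄
  | .unbox h₁ rfl h₃ h₄ h₅ =>
    have h₅ := h₅.subst hσ θ
    have h₁ := h₁.subst hσ hθ hρ
    simp only [Expr.subst, Ty.subst, Idx.subst, Idx.substL] at h₁ h₅ ⊢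
    refine .unbox h₁ rfl ?_ (h₄.subst hσ hθ) h₅
    have := h₃.subst (hσ.up _) (hθ.shiftI _) ((hρ.upI _).up [_])
    rwa [Ty.shiftI_subst_up] at this
termination_by structural h
theorem HasAtomType.subst {Θ : List Srt} {Δ : List Knd} {Γ : List (Ty S.Base)} {a : Atom S}
    {τ : Ty S.Base} (h : HasAtomType Θ Δ Γ a τ) {Θ' : List Srt} {Δ' : List Knd}
    {Γ' : List (Ty S.Base)} {σ : ℕ → Idx} {θ : ℕ → Ty S.Base} {ρ : ℕ → Expr S}
    (hσ : SortSub Θ Θ' σ) (hθ : KindSub Θ' Δ Δ' θ) (hρ : TermSub Θ' Δ' Γ' σ θ ρ Γ) :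
    HasAtomType Θ' Δ' Γ' (a.subst σ θ ρ) (τ.subst σ θ) := by
  match h with
  | .eqv h h' => exact .eqv (h.subst hσ hθ hρ) (h'.subst hσ θ)
  | .const c => exact .const c
  | .op o => rw [(S.op_wf o).subst_eq_self (by simp) (by simp)]; exact .op o
  | .lam h₁ h₂ =>
    rw [Atom.subst, Ty.subst, Ty.substL_eq_map]
    refine .lam (fun τ hτ => ?_) (h₂.subst hσ hθ (hρ.up _))
    obtain ⟨τ, hτ', rfl⟩ := List.mem_map.mp hτ
    exact (h₁ τ hτ').subst hσ hθ
  | .tlam h₁ h₂ => exact .tlam (h₁.subst _ _ _) (h₂.subst hσ (hθ.up _) (hρ.upT _))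
  | .ilam h₁ h₂ => exact .ilam (h₁.subst _ _ _) (h₂.subst (hσ.up _) (hθ.shiftI _) (hρ.upI _))
  | .box h₁ h₂ h₃ h₄ =>
    have h₄ := h₄.subst hσ hθ hρ
    rw [Ty.instI_subst _ _ h₂] at h₄
    exact .box (h₁.subst hσ hθ) (by simpa using h₂)
      (forall_mem_zip_map_left fun p hp => (h₃ p hp).subst hσ) h₄
termination_by structural h
end

/-! ## Regularity -/

-- Regularity. Its main use is to supply the well-sortedness that is required whenever a shape in a
-- type is replaced by another one with the same value.
mutual
theorem HasType.hasKind {Θ : List Srt} {Δ : List Knd} {Γ : List (Ty S.Base)} {e : Expr S}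
    {τ : Ty S.Base} (h : HasType Θ Δ Γ e τ) (hΓ : ∀ τ ∈ Γ, HasKind Θ Δ τ .array) :
    HasKind Θ Δ τ .array := by
  match h with
  | .eqv h h' => exact (h.hasKind hΓ).eqv h'
  | .var h => exact hΓ _ (List.mem_of_getElem? h)
  | .array h₁ h₂ h₃ h₄ => exact .arr h₂ (hasSort_lit _ _)
  | .frame h₁ h₂ h₃ h₄ =>
    cases h₂ with
    | arr h h' => exact .arr h (hasSort_app.mpr ⟨hasSort_lit _ _, h'⟩)
  | .app h₁ h₂ h₃ h₄ h₅ h₆ =>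
    -- The maximum is a member of the list and hence a prefix of itself; the equality that witnesses
    -- this shows that it is well-sorted.
    obtain ⟨w, hw⟩ := h₅.2 _ h₅.1
    cases h₁.hasKind hΓ with
    | arr h h' =>
      cases h with
      | fn _ h =>
        cases h with
        | arr h h'' => exact .arr h (hasSort_app.mpr ⟨hw.2.1, h''⟩)
  | .tapp h₁ h₂ h₃ h₄ =>
    cases h₁.hasKind hΓ with
    | arr h h' =>
      cases h with
      | all h =>
        cases h with
        | arr h h'' => exact .arr (h.instT h₂ h₃) (hasSort_app.mpr ⟨h', h''⟩)
  | .iapp h₁ h₂ h₃ h₄ =>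
    cases h₁.hasKind hΓ with
    | arr h h' =>
      cases h with
      | pi h =>
        cases h with
        | arr h h'' =>
          exact .arr (h.instI h₂ h₃)
            (hasSort_app.mpr ⟨h', h''.subst (sortSub_scons h₂ h₃ (sortSub_var _))⟩)
  | .unbox h₁ h₂ h₃ h₄ h₅ =>
    cases h₁.hasKind hΓ with
    | arr _ h' =>
      cases h₄ with
      | arr h h'' => exact .arr h (hasSort_app.mpr ⟨h', h''⟩)
termination_by structural h
theorem HasAtomType.hasKind {Θ : List Srt} {Δ : List Knd} {Γ : List (Ty S.Base)} {a : Atom S}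
    {τ : Ty S.Base} (h : HasAtomType Θ Δ Γ a τ) (hΓ : ∀ τ ∈ Γ, HasKind Θ Δ τ .array) :
    HasKind Θ Δ τ .atom := by
  match h with
  | .eqv h h' => exact (h.hasKind hΓ).eqv h'
  | .const c => exact .base _
  | .op o => exact (S.op_wf o).weaken Θ Δ
  | .lam h₁ h₂ =>
    refine .fn h₁ (h₂.hasKind fun τ hτ => ?_)
    rcases List.mem_append.mp hτ with hτ | hτ
    exacts [h₁ τ hτ, hΓ τ hτ]
  | .tlam h₁ h₂ =>
    refine .all (h₂.hasKind fun τ hτ => ?_)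
    obtain ⟨τ, hτ', rfl⟩ := List.mem_map.mp hτ
    exact (hΓ τ hτ').shiftT _
  | .ilam h₁ h₂ =>
    refine .pi (h₂.hasKind fun τ hτ => ?_)
    obtain ⟨τ, hτ', rfl⟩ := List.mem_map.mp hτ
    exact (hΓ τ hτ').shiftI _
  | .box h₁ h₂ h₃ h₄ => exact h₁
termination_by structural h
end

theorem HasType.hasKind_closed {e : Expr S} {τ : Ty S.Base} (h : HasType [] [] [] e τ) :
    HasKind [] [] τ .array :=
  h.hasKind (by simp)

/-! ## Inversion of typing -/

/-- What the last rule other than type equivalence in a derivation of `e : T` says. -/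
def Expr.Inversion (Θ : List Srt) (Δ : List Knd) (Γ : List (Ty S.Base)) (T : Ty S.Base) :
    Expr S → Prop
  | .var x => ∃ τ, Γ[x]? = some τ ∧ TEqv Θ τ T
  | .array ds as tag => ∃ τ, (∀ a ∈ as, HasAtomType Θ Δ Γ a τ) ∧ HasKind Θ Δ τ .atom ∧
      as.length = ds.prod ∧ TEqv Θ tag (.arr τ (.lit ds)) ∧ TEqv Θ (.arr τ (.lit ds)) T
  | .frame ds es tag => ∃ τ ι, (∀ e ∈ es, HasType Θ Δ Γ e (.arr τ ι)) ∧
      HasKind Θ Δ (.arr τ ι) .array ∧ es.length = ds.prod ∧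
      TEqv Θ tag (.arr τ (.app [.lit ds, ι])) ∧ TEqv Θ (.arr τ (.app [.lit ds, ι])) T
  | .app f es tag => ∃ (cells : List (Ty S.Base × Idx)) (frames : List Idx) (τo : Ty S.Base)
      (ιf ιo ιp : Idx),
      HasType Θ Δ Γ f (.arr (.fn (cells.map fun c => .arr c.1 c.2) (.arr τo ιo)) ιf) ∧
      es.length = cells.length ∧ frames.length = cells.length ∧
      (∀ (i : ℕ) (e : Expr S) (c : Ty S.Base × Idx) (ι : Idx),
        es[i]? = some e → cells[i]? = some c → frames[i]? = some ι →
        HasType Θ Δ Γ e (.arr c.1 (.app [ι, c.2]))) ∧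
      IsMax Θ ιp (ιf :: frames) ∧
      TEqv Θ tag (.arr τo (.app [ιp, ιo])) ∧ TEqv Θ (.arr τo (.app [ιp, ιo])) T
  | .tapp f τs tag => ∃ ks τ ιf ι, HasType Θ Δ Γ f (.arr (.all ks (.arr τ ι)) ιf) ∧
      τs.length = ks.length ∧ (∀ p ∈ τs.zip ks, HasKind Θ Δ p.1 p.2) ∧
      TEqv Θ tag (.arr (τ.instT τs) (.app [ιf, ι])) ∧
      TEqv Θ (.arr (τ.instT τs) (.app [ιf, ι])) T
  | .iapp f ιs tag => ∃ γs τ ιf ι, HasType Θ Δ Γ f (.arr (.pi γs (.arr τ ι)) ιf) ∧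
      ιs.length = γs.length ∧ (∀ p ∈ ιs.zip γs, HasSort Θ p.1 p.2) ∧
      TEqv Θ tag (.arr (τ.instI ιs) (.app [ιf, ι.subst (scons ιs .var)])) ∧
      TEqv Θ (.arr (τ.instI ιs) (.app [ιf, ι.subst (scons ιs .var)])) T
  | .unbox n e b tag => ∃ γs τ τb ιs ιb, HasType Θ Δ Γ e (.arr (.sigma γs τ) ιs) ∧
      γs.length = n ∧
      HasType (γs ++ Θ) Δ (τ :: Γ.map (Ty.shiftI n)) b ((Ty.arr τb ιb).shiftI n) ∧
      HasKind Θ Δ (.arr τb ιb) .array ∧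
      TEqv Θ tag (.arr τb (.app [ιs, ιb])) ∧ TEqv Θ (.arr τb (.app [ιs, ιb])) T

/-- The only recursive case is conversion, where transitivity absorbs one more equivalence into the
last component. -/
theorem HasType.inversion {Θ : List Srt} {Δ : List Knd} {Γ : List (Ty S.Base)} {e : Expr S}
    {T : Ty S.Base} (h : HasType Θ Δ Γ e T) : e.Inversion Θ Δ Γ T := by
  match h with
  | .eqv h h' =>
    have ih := h.inversion
    cases e with
    | var =>
      obtain ⟨τ, h₁, h₂⟩ := ih
      exact ⟨τ, h₁, h₂.trans h'⟩
    | array =>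
      obtain ⟨τ, h₁, h₂, h₃, h₄, h₅⟩ := ih
      exact ⟨τ, h₁, h₂, h₃, h₄, h₅.trans h'⟩
    | frame =>
      obtain ⟨τ, ι, h₁, h₂, h₃, h₄, h₅⟩ := ih
      exact ⟨τ, ι, h₁, h₂, h₃, h₄, h₅.trans h'⟩
    | app =>
      obtain ⟨cells, frames, τo, ιf, ιo, ιp, h₁, h₂, h₃, h₄, h₅, h₆, h₇⟩ := ih
      exact ⟨cells, frames, τo, ιf, ιo, ιp, h₁, h₂, h₃, h₄, h₅, h₆, h₇.trans h'⟩
    | tapp =>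
      obtain ⟨ks, τ, ιf, ι, h₁, h₂, h₃, h₄, h₅⟩ := ih
      exact ⟨ks, τ, ιf, ι, h₁, h₂, h₃, h₄, h₅.trans h'⟩
    | iapp =>
      obtain ⟨ks, τ, ιf, ι, h₁, h₂, h₃, h₄, h₅⟩ := ih
      exact ⟨ks, τ, ιf, ι, h₁, h₂, h₃, h₄, h₅.trans h'⟩
    | unbox =>
      obtain ⟨γs, τ, τb, ιs, ιb, h₁, h₂, h₃, h₄, h₅, h₆⟩ := ih
      exact ⟨γs, τ, τb, ιs, ιb, h₁, h₂, h₃, h₄, h₅, h₆.trans h'⟩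
  | .var h => exact ⟨_, h, .refl _⟩
  | .array h₁ h₂ h₃ h₄ => exact ⟨_, h₁, h₂, h₃, h₄, .refl _⟩
  | .frame h₁ h₂ h₃ h₄ => exact ⟨_, _, h₁, h₂, h₃, h₄, .refl _⟩
  | .app h₁ h₂ h₃ h₄ h₅ h₆ => exact ⟨_, _, _, _, _, _, h₁, h₂, h₃, h₄, h₅, h₆, .refl _⟩
  | .tapp h₁ h₂ h₃ h₄ => exact ⟨_, _, _, _, h₁, h₂, h₃, h₄, .refl _⟩
  | .iapp h₁ h₂ h₃ h₄ => exact ⟨_, _, _, _, h₁, h₂, h₃, h₄, .refl _⟩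
  | .unbox h₁ h₂ h₃ h₄ h₅ => exact ⟨_, _, _, _, _, h₁, h₂, h₃, h₄, h₅, .refl _⟩
termination_by structural h

/-- What the last rule other than type equivalence in a derivation of `a : T` says. -/
def Atom.Inversion (Θ : List Srt) (Δ : List Knd) (Γ : List (Ty S.Base)) (T : Ty S.Base) :
    Atom S → Prop
  | .const c => TEqv Θ (.base (S.constTy c)) T
  | .op o => TEqv Θ (.fn (S.opIn o) (S.opOut o)) T
  | .lam ins b => ∃ τ, (∀ τi ∈ ins, HasKind Θ Δ τi .array) ∧ HasType Θ Δ (ins ++ Γ) b τ ∧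
      TEqv Θ (.fn ins τ) T
  | .tlam ks b => ∃ τ, IsVal b ∧ HasType Θ (ks ++ Δ) (Γ.map (Ty.shiftT ks.length)) b τ ∧
      TEqv Θ (.all ks τ) T
  | .ilam γs b => ∃ τ, IsVal b ∧ HasType (γs ++ Θ) Δ (Γ.map (Ty.shiftI γs.length)) b τ ∧
      TEqv Θ (.pi γs τ) T
  | .box ιs e τ' => ∃ γs τ, τ' = .sigma γs τ ∧ HasKind Θ Δ (.sigma γs τ) .atom ∧
      ιs.length = γs.length ∧ (∀ p ∈ ιs.zip γs, HasSort Θ p.1 p.2) ∧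
      HasType Θ Δ Γ e (τ.instI ιs) ∧ TEqv Θ (.sigma γs τ) T

theorem HasAtomType.inversion {Θ : List Srt} {Δ : List Knd} {Γ : List (Ty S.Base)} {a : Atom S}
    {T : Ty S.Base} (h : HasAtomType Θ Δ Γ a T) : a.Inversion Θ Δ Γ T := by
  match h with
  | .eqv h h' =>
    have ih := h.inversion
    cases a with
    | const | op => exact TEqv.trans ih h'
    | lam | tlam | ilam =>
      obtain ⟨τ, h₁, h₂, h₃⟩ := ih
      exact ⟨τ, h₁, h₂, h₃.trans h'⟩
    | box =>
      obtain ⟨γs, τ, h₁, h₂, h₃, h₄, h₅, h₆⟩ := ih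
      exact ⟨γs, τ, h₁, h₂, h₃, h₄, h₅, h₆.trans h'⟩
  | .const c => exact .refl _
  | .op o => exact .refl _
  | .lam h₁ h₂ => exact ⟨_, h₁, h₂, .refl _⟩
  | .tlam h₁ h₂ => exact ⟨_, h₁, h₂, .refl _⟩
  | .ilam h₁ h₂ => exact ⟨_, h₁, h₂, .refl _⟩
  | .box h₁ h₂ h₃ h₄ => exact ⟨_, _, rfl, h₁, h₂, h₃, h₄, .refl _⟩
termination_by structural h

/-! ## Closed types -/

/-- Only the values of the shapes are compared, which also covers reflexivity at ill-sorted shapes.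
The converse `TEqv.arr_of_val` has to assume the sorts. -/
theorem TEqv.arr_arr {τ τ' : Ty S.Base} {ι ι' : Idx} (h : TEqv [] (.arr τ ι) (.arr τ' ι')) :
    TEqv [] τ τ' ∧ ι.val = ι'.val := by
  cases h with
  | refl => exact ⟨.refl _, rfl⟩
  | arr h h' => exact ⟨h, (idxEqv_nil_iff.mp h').2.2⟩

theorem HasKind.of_arr {Θ : List Srt} {Δ : List Knd} {τ : Ty S.Base} {ι : Idx} {k : Knd}
    (h : HasKind Θ Δ (.arr τ ι) k) : HasKind Θ Δ τ .atom ∧ HasSort Θ ι .shape := by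
  cases h with
  | arr h h' => exact ⟨h, h'⟩

theorem TEqv.arr_of_val {τ τ' : Ty S.Base} {ι ι' : Idx} (h : TEqv [] τ τ')
    (hι : HasSort [] ι .shape) (hι' : HasSort [] ι' .shape) (hv : ι.val = ι'.val) :
    TEqv [] (.arr τ ι) (.arr τ' ι') :=
  .arr h (idxEqv_nil_iff.mpr ⟨hι, hι', hv⟩)

theorem TEqv.fn_fn {Θ : List Srt} {ins ins' : List (Ty S.Base)} {out out' : Ty S.Base}
    (h : TEqv Θ (.fn ins out) (.fn ins' out')) :
    List.Forall₂ (TEqv Θ) ins ins' ∧ TEqv Θ out out' := by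
  obtain ⟨_, _, he, h⟩ := h.fn_inv
  cases he
  exact h

/-- The type of an array literal is determined by its tag. -/
theorem HasType.array_tag {Θ : List Srt} {Δ : List Knd} {Γ : List (Ty S.Base)} {ds : List ℕ}
    {as : List (Atom S)} {tag T : Ty S.Base} (h : HasType Θ Δ Γ (.array ds as tag) T) :
    TEqv Θ tag T := by
  obtain ⟨τ, -, -, -, h, h'⟩ := h.inversion
  exact h.trans h'

/-- Reduction creates literals with literal tags, whereas the application rule expects a frame
followed by the cell index; any well-sorted shape of the right value will do. -/
theorem HasType.array_of_kind {Δ : List Knd} {Γ : List (Ty S.Base)} {ds : List ℕ}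
    {as : List (Atom S)} {τ : Ty S.Base} {ι : Idx} (h : ∀ a ∈ as, HasAtomType [] Δ Γ a τ)
    (hτ : HasKind [] Δ τ .atom) (hl : as.length = ds.prod) (hι : HasSort [] ι .shape)
    (hv : ι.val = ds) : HasType [] Δ Γ (.array ds as (.arr τ (.lit ds))) (.arr τ ι) :=
  .eqv (.array h hτ hl (.refl _)) (.arr_of_val (.refl _) (hasSort_lit _ _) hι (by simp [hv]))

/-! ## Splitting and replicating lists -/

theorem length_split {α : Type*} (k n : ℕ) (xs : List α) : (split k n xs).length = k := by
  simp [split]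

theorem mem_split {α : Type*} {k n : ℕ} {xs l : List α} (h : l ∈ split k n xs)
    (hl : xs.length = k * n) : l.length = n ∧ ∀ x ∈ l, x ∈ xs := by
  simp only [split, List.mem_map, List.mem_range] at h
  obtain ⟨j, hj, rfl⟩ := h
  refine ⟨?_, fun x hx => List.mem_of_mem_drop (List.mem_of_mem_take hx)⟩
  simp only [List.length_take, List.length_drop, hl]
  -- The `j`-th piece ends at position `(j + 1) * n`, within the list, so `take` is not cut short.
  have : (j + 1) * n ≤ k * n := Nat.mul_le_mul_right n hj
  rw [Nat.succ_mul] at this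
  omega

theorem mem_flatten_rep {α : Type*} {m : ℕ} {xss : List (List α)} {x : α}
    (h : x ∈ (rep m xss).flatten) : ∃ l ∈ xss, x ∈ l := by
  simp only [rep, List.mem_flatten, List.mem_flatMap, List.mem_replicate] at h
  obtain ⟨l, ⟨l', hl', -, rfl⟩, hx⟩ := h
  exact ⟨l, hl', hx⟩

theorem length_flatten_of_forall {α : Type*} {n : ℕ} {xss : List (List α)}
    (h : ∀ l ∈ xss, l.length = n) : xss.flatten.length = xss.length * n := by
  rw [List.length_flatten, List.map_congr_left h]
  simp

theorem length_rep {α : Type*} (m : ℕ) (xss : List (List α)) :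
    (rep m xss).length = xss.length * m := by
  simp [rep, List.length_flatMap]

/-- The atom count after a lift: `k` is the size of the old frame, `m` the number of copies of each
cell, and `n` the size of a cell. -/
theorem length_flatten_rep_split {α : Type*} {m k n : ℕ} {xs : List α} (h : xs.length = k * n) :
    (rep m (split k n xs)).flatten.length = k * m * n := by
  rw [length_flatten_of_forall (n := n), length_rep, length_split]
  intro l hl
  simp only [rep, List.mem_flatMap, List.mem_replicate] at hl
  obtain ⟨l', hl', -, rfl⟩ := hl
  exact (mem_split hl' h).1

theorem mem_flatten_rep_split {α : Type*} {m k n : ℕ} {xs : List α} (h : xs.length = k * n)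
    {x : α} (hx : x ∈ (rep m (split k n xs)).flatten) : x ∈ xs := by
  obtain ⟨l, hl, hx⟩ := mem_flatten_rep hx
  exact (mem_split hl h).2 x hx

theorem prod_mul_prod_drop {n np : List ℕ} (h : n <+: np) :
    n.prod * (np.drop n.length).prod = np.prod := by
  obtain ⟨t, rfl⟩ := h
  simp

theorem prefix_antisymm {α : Type*} {l l' : List α} (h : l <+: l') (h' : l' <+: l) : l = l' :=
  h.eq_of_length (le_antisymm h.length_le h'.length_le)

theorem map_zip_map_self {α β γ : Type*} (l : List α) (f : α → β) (g : α × β → γ) :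
    (l.zip (l.map f)).map g = l.map fun x => g (x, f x) := by
  induction l <;> simp_all

theorem forall_mem_zip {α β : Type*} {l : List α} {l' : List β} {P : α × β → Prop} :
    (∀ p ∈ l.zip l', P p) ↔ ∀ (i : ℕ) (h : i < l.length) (h' : i < l'.length), P (l[i], l'[i]) := by
  constructor
  · intro h i hi hi'
    exact h _ (List.mem_iff_getElem.mpr ⟨i, by simpa using ⟨hi, hi'⟩, by simp⟩)
  · intro h p hp
    obtain ⟨i, hi, rfl⟩ := List.mem_iff_getElem.mp hp
    simp only [List.length_zip, lt_inf_iff] at hi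
    simpa using h i hi.1 hi.2

/-! ## Applications to array literals -/

/-- The facts about the application of an array literal to array literals that are used when
cells are replicated, or when the function is mapped over the cells. -/
theorem HasType.app_lit_inv {nf : List ℕ} {fs : List (Atom S)} {args : List (AppArg S)} {ιf : Idx}
    {out tag T : Ty S.Base}
    (h : HasType [] [] [] (.app (.array nf fs (.arr (.fn (args.map AppArg.inTy) out) ιf))
      (args.map AppArg.expr) tag) T)
    (hok : ∀ a ∈ args, a.Ok) (hιf : IdxEqv [] ιf (.lit nf)) :
    ∃ τo ιo np, out = .arr τo ιo ∧
      HasKind [] [] (.fn (args.map AppArg.inTy) out) .atom ∧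
      (∀ f ∈ fs, HasAtomType [] [] [] f (.fn (args.map AppArg.inTy) out)) ∧
      fs.length = nf.prod ∧
      (∀ a ∈ args, (∀ x ∈ a.atoms, HasAtomType [] [] [] x a.cellTy) ∧
        a.atoms.length = (a.frame ++ a.cell).prod) ∧
      np ∈ nf :: args.map AppArg.frame ∧ (∀ n ∈ nf :: args.map AppArg.frame, n <+: np) ∧
      TEqv [] tag (.arr τo (.app [.lit np, ιo])) ∧ TEqv [] tag T := by
  obtain ⟨cells, frames, τo, ιf', ιo, ιp, hf, hlen, hlen', hargs, hmax, htag, hT⟩ := h.inversion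
  obtain ⟨τ, hfs, hkf, hlf, htf, htf'⟩ := hf.inversion
  have hfn := hf.array_tag.arr_arr.1
  have hkfn : HasKind [] [] (.fn (args.map AppArg.inTy) out) .atom :=
    (hf.hasKind_closed.eqv hf.array_tag.symm).of_arr.1
  have hιfv : ιf'.val = nf := by
    rw [← hf.array_tag.arr_arr.2, (idxEqv_nil_iff.mp hιf).2.2, Idx.val_lit]
  obtain ⟨hins, hout⟩ := hfn.fn_fn
  obtain ⟨τo', ιo', rfl, -⟩ := hout.symm.arr_inv
  obtain ⟨hτo, hιo⟩ := hout.arr_arr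
  -- The frames of the derivation are those recorded in the redex: the tag of an argument gives the
  -- same total shape for both, the function's tag gives the same cell shape, and the cell is
  -- cancelled on the right.
  have hframes : frames.map Idx.val = args.map AppArg.frame := by
    refine List.ext_getElem (by simp at hlen ⊢; omega) fun i hi hi' => ?_
    simp only [List.length_map] at hi hi' hlen
    have hc : i < cells.length := by omega
    have ht := hargs i _ _ _ (List.getElem?_eq_getElem (by simpa using hi'))
      (List.getElem?_eq_getElem hc) (List.getElem?_eq_getElem hi)
    rw [List.getElem_map] at ht
    have hok' := hok args[i] (List.getElem_mem _)
    have h₁ := (hok'.2.1.symm.trans ht.array_tag).arr_arr.2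
    have h₂ := hins.get (i := i) (by simpa using hi') (by simpa using hc)
    simp only [List.get_eq_getElem, List.getElem_map, AppArg.inTy] at h₂
    have h₃ := h₂.arr_arr.2
    rw [(idxEqv_nil_iff.mp hok'.1).2.2, Idx.val_lit] at h₃
    rw [Idx.val_lit, Idx.val_app, ← h₃] at h₁
    simpa using (List.append_cancel_right h₁).symm
  refine ⟨τo', ιo', ιp.val, rfl, hkfn, fun f hf' => ?_, hlf, fun a ha => ?_, ?_, ?_, ?_, ?_⟩
  · exact .eqv (hfs f hf') htf.symm.arr_arr.1
  · obtain ⟨i, hi, rfl⟩ := List.mem_iff_getElem.mp ha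
    simp only [List.length_map] at hlen
    have ht := hargs i _ _ _ (List.getElem?_eq_getElem (by simpa using hi))
      (List.getElem?_eq_getElem (by omega)) (List.getElem?_eq_getElem (by omega))
    rw [List.getElem_map] at ht
    obtain ⟨τ', hx, -, hl, htag', -⟩ := ht.inversion
    exact ⟨fun x hx' => .eqv (hx x hx') (htag'.symm.trans (hok _ ha).2.1).arr_arr.1, hl⟩
  · rw [← hframes, ← hιfv, ← List.map_cons (f := Idx.val)]
    exact List.mem_map_of_mem hmax.1
  · rw [← hframes, ← hιfv, ← List.map_cons (f := Idx.val)]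
    intro n hn
    obtain ⟨ι, hι, rfl⟩ := List.mem_map.mp hn
    exact prefix_nil (hmax.2 ι hι)
  · refine htag.trans (.arr_of_val hτo.symm ?_ ?_ (by simp [hιo]))
    · exact (h.hasKind_closed.eqv hT.symm).of_arr.2
    · cases hkfn with
      | fn _ h => exact hasSort_app.mpr ⟨hasSort_lit _ _, h.of_arr.2⟩
  · exact htag.trans hT

/-- An application in which all frames are equal. -/
theorem HasType.app_uniform {f : Expr S} {es : List (Expr S)} {args : List (AppArg S)}
    {np : List ℕ} {τo tag : Ty S.Base} {ιo : Idx}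
    (hf : HasType [] [] [] f (.arr (.fn (args.map AppArg.inTy) (.arr τo ιo)) (.lit np)))
    (hes : List.Forall₂ (fun e a => HasType [] [] [] e
      (.arr a.cellTy (.app [.lit np, a.cellIdx]))) es args)
    (htag : TEqv [] tag (.arr τo (.app [.lit np, ιo]))) :
    HasType [] [] [] (.app f es tag) (.arr τo (.app [.lit np, ιo])) := by
  refine .app (cells := args.map fun a => (a.cellTy, a.cellIdx))
    (frames := args.map fun _ => .lit np) (ιf := .lit np) ?_ ?_ ?_ ?_ ?_ htag
  · rw [List.map_map]
    exact hf
  · simpa using hes.length_eq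
  · simp
  · intro i e c ι he hc hι
    simp only [List.getElem?_map, Option.map_eq_some_iff] at hc hι
    obtain ⟨a, ha, rfl⟩ := hc
    obtain ⟨-, -, rfl⟩ := hι
    obtain ⟨hi, rfl⟩ := List.getElem?_eq_some_iff.mp he
    obtain ⟨hi', rfl⟩ := List.getElem?_eq_some_iff.mp ha
    exact hes.get hi hi'
  -- All frames coincide, so each is a prefix of the maximum with empty remainder.
  · refine ⟨by simp, fun ι hι => ⟨.lit [], ?_⟩⟩
    have : ι = .lit np := by
      rcases List.mem_cons.mp hι with h | h
      · exact h
      · obtain ⟨-, -, rfl⟩ := List.mem_map.mp h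
        rfl
    subst this
    exact idxEqv_nil_iff.mpr ⟨hasSort_app.mpr ⟨hasSort_lit _ _, hasSort_lit _ _⟩,
      hasSort_lit _ _, by simp⟩

theorem HasKind.fn_inv {Θ : List Srt} {Δ : List Knd} {ins : List (Ty S.Base)} {out : Ty S.Base}
    {k : Knd} (h : HasKind Θ Δ (.fn ins out) k) :
    (∀ τ ∈ ins, HasKind Θ Δ τ .array) ∧ HasKind Θ Δ out .array := by
  cases h with
  | fn h h' => exact ⟨h, h'⟩

section Redexes

variable {nf np : List ℕ} {fs : List (Atom S)} {args : List (AppArg S)} {ιf : Idx}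
  {out tag T : Ty S.Base}

/-- The result type depends on the frames only through the principal one. After replication every
frame is principal, so the type and even the tag are unchanged. -/
theorem HasType.lift
    (h : HasType [] [] [] (.app (.array nf fs (.arr (.fn (args.map AppArg.inTy) out) ιf))
      (args.map AppArg.expr) tag) T)
    (hok : ∀ a ∈ args, a.Ok) (hιf : IdxEqv [] ιf (.lit nf))
    (hnp : np ∈ nf :: args.map AppArg.frame) (hpre : ∀ n ∈ nf :: args.map AppArg.frame, n <+: np) :
    HasType [] [] [] (.app (.array np (rep (np.drop nf.length).prod (split nf.prod 1 fs)).flatten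
      (.arr (.fn (args.map AppArg.inTy) out) (.lit np))) (args.map (AppArg.lifted np)) tag) T := by
  obtain ⟨τo, ιo, np', rfl, hk, hfs, hlf, hargs, hnp', hpre', htag, hT⟩ := h.app_lit_inv hok hιf
  -- Both are members of the same list and prefix-maximal in it: one by typing, one by the side
  -- condition of the redex.
  obtain rfl : np' = np := prefix_antisymm (hpre _ hnp') (hpre' _ hnp)
  refine .eqv (HasType.app_uniform (.array_of_kind ?_ hk ?_ (hasSort_lit _ _) (by simp)) ?_ htag)
    (htag.symm.trans hT)
  · exact fun f hf => hfs f (mem_flatten_rep_split (by simpa using hlf) hf)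
  · rw [length_flatten_rep_split (by simpa using hlf), mul_one,
      prod_mul_prod_drop (hpre nf (by simp))]
  · rw [List.forall₂_map_left_iff, List.forall₂_same]
    intro a ha
    have hka := (hk.fn_inv.1 _ (List.mem_map_of_mem ha)).of_arr
    have hla := (hargs a ha).2
    rw [List.prod_append] at hla
    refine .array_of_kind (fun x hx => (hargs a ha).1 x (mem_flatten_rep_split hla hx)) hka.1 ?_
      (hasSort_app.mpr ⟨hasSort_lit _ _, hka.2⟩) ?_
    · rw [AppArg.cells, length_flatten_rep_split hla, List.prod_append,
        prod_mul_prod_drop (hpre _ (List.mem_cons_of_mem _ (List.mem_map_of_mem ha)))]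
    · rw [Idx.val_app, Idx.val_lit, (idxEqv_nil_iff.mp (hok a ha).1).2.2, Idx.val_lit]

/-- Each cell-wise application has empty principal frame and so the output type of the function; the
surrounding frame restores `nf`. -/
theorem HasType.map
    (h : HasType [] [] [] (.app (.array nf fs (.arr (.fn (args.map AppArg.inTy) out) ιf))
      (args.map AppArg.expr) tag) T)
    (hok : ∀ a ∈ args, a.Ok) (hιf : IdxEqv [] ιf (.lit nf))
    (hfr : ∀ a ∈ args, a.frame = nf) :
    HasType [] [] [] (.frame nf
      ((fs.zip (transpose nf.prod (args.map AppArg.cells))).map fun p =>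
        .app (.array [] [p.1] (.arr (.fn (args.map AppArg.inTy) out) (.lit [])))
          ((args.zip p.2).map fun q => .array q.1.cell q.2 (.arr q.1.cellTy (.lit q.1.cell)))
          out) tag) T := by
  obtain ⟨τo, ιo, np', rfl, hk, hfs, hlf, hargs, hnp', hpre', htag, hT⟩ := h.app_lit_inv hok hιf
  obtain rfl : np' = nf := by
    rcases List.mem_cons.mp hnp' with h | h
    · exact h
    · obtain ⟨a, ha, rfl⟩ := List.mem_map.mp h
      exact hfr a ha
  have hko := hk.fn_inv.2
  refine .eqv (.frame (τ := τo) (ι := ιo) ?_ hko ?_ htag) (htag.symm.trans hT)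
  · intro e he
    obtain ⟨⟨f, l⟩, hp, rfl⟩ := List.mem_map.mp he
    obtain ⟨hf, hl⟩ := List.of_mem_zip hp
    simp only [transpose, List.mem_map, List.mem_range] at hl
    obtain ⟨j, hj, rfl⟩ := hl
    have hs : HasSort [] (Idx.app [.lit [], ιo]) .shape :=
      hasSort_app.mpr ⟨hasSort_lit _ _, hko.of_arr.2⟩
    -- The application rule gives the empty shape followed by `ιo`; this differs syntactically from
    -- the tag `out` but has the same value.
    refine .eqv (HasType.app_uniform (.array_of_kind (by simpa using hfs f hf) hk (by simp)
      (hasSort_lit _ _) (by simp)) ?_ (.arr_of_val (.refl _) hko.of_arr.2 hs (by simp)))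
      (.arr_of_val (.refl _) hs hko.of_arr.2 (by simp))
    rw [List.map_map, map_zip_map_self, List.forall₂_map_left_iff, List.forall₂_same]
    intro a ha
    have hka := (hk.fn_inv.1 _ (List.mem_map_of_mem ha)).of_arr
    have hla := (hargs a ha).2
    rw [List.prod_append, hfr a ha] at hla
    -- Position `j` lies inside the frame, so the default of `getD` is never taken and the entry is
    -- a genuine cell.
    have hmem : a.cells.getD j [] ∈ split np'.prod a.cell.prod a.atoms := by
      have : j < a.cells.length := by rwa [AppArg.cells, length_split, hfr a ha]
      rw [List.getD_eq_getElem _ _ this, ← hfr a ha]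
      exact List.getElem_mem _
    obtain ⟨hl₁, hl₂⟩ := mem_split hmem hla
    refine .array_of_kind (fun x hx => (hargs a ha).1 x (hl₂ x hx)) hka.1 hl₁
      (hasSort_app.mpr ⟨hasSort_lit _ _, hka.2⟩) ?_
    rw [Idx.val_app, Idx.val_lit, (idxEqv_nil_iff.mp (hok a ha).1).2.2, Idx.val_lit, List.nil_append]
  · simp [transpose, hlf]

end Redexes

/-! ## Preservation -/

/-- An application of a scalar whose arguments are tagged with its input types. -/
theorem HasType.app_scalar_inv {a : Atom S} {args : List (Expr S)} {ins : List (Ty S.Base)}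
    {tagf tag T : Ty S.Base} {P : Ty S.Base → Prop}
    (h : HasType [] [] [] (.app (.array [] [a] tagf) args tag) T)
    (hargs : ∀ p ∈ args.zip ins, ∃ ds as τ, p.1 = .array ds as τ ∧ TEqv [] τ p.2)
    (hl : args.length = ins.length)
    (ha : ∀ T, HasAtomType [] [] [] a T → ∃ out, P out ∧ TEqv [] (.fn ins out) T) :
    ∃ out, P out ∧ TEqv [] out T ∧ ∀ p ∈ args.zip ins, HasType [] [] [] p.1 p.2 := by
  obtain ⟨cells, frames, τo, ιf, ιo, ιp, hf, hlen, hlen', hcell, hmax, -, hT⟩ := h.inversion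
  obtain ⟨τ, hfs, -, -, -, hf'⟩ := hf.inversion
  obtain ⟨hτ, hιf⟩ := hf'.arr_arr
  obtain ⟨out, hP, hout⟩ := ha _ (.eqv (hfs a (by simp)) hτ)
  obtain ⟨hins, hout⟩ := hout.fn_fn
  rw [forall_mem_zip] at hargs
  -- The tag of an argument is equivalent both to its input type and to the type with the frame
  -- prepended; comparing lengths forces an empty frame.
  have key : ∀ (i : ℕ) (hi : i < args.length) (hi' : i < ins.length) (hi'' : i < frames.length),
      HasType [] [] [] args[i] ins[i] ∧ frames[i].val = [] := by
    intro i hi hi' hi''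
    have hc : i < cells.length := by omega
    have ht := hcell i _ _ _ (List.getElem?_eq_getElem hi)
      (List.getElem?_eq_getElem hc) (List.getElem?_eq_getElem hi'')
    obtain ⟨ds, as, τ, he, htag⟩ := hargs i hi hi'
    simp only at he htag
    rw [he] at ht
    have htag' := htag.symm.trans ht.array_tag
    refine ⟨by rw [he]; exact .eqv ht htag'.symm, ?_⟩
    have h₂ := hins.get hi' (by simpa using hc)
    simp only [List.get_eq_getElem, List.getElem_map] at h₂
    simpa using (h₂.symm.trans htag').arr_arr.2
  -- The principal frame is the shape of the scalar function or the frame of an argument, and all of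
  -- these are empty.
  have hp : ιp.val = [] := by
    rcases List.mem_cons.mp hmax.1 with h | h
    · rw [h, ← hιf, Idx.val_lit]
    · obtain ⟨i, hi, rfl⟩ := List.mem_iff_getElem.mp h
      exact (key i (by omega) (by omega) hi).2
  have hk := (h.hasKind_closed.eqv hT.symm).of_arr.2
  refine ⟨out, hP, hout.trans ((TEqv.arr_of_val (.refl _) (hasSort_app.mp hk).2 hk
    (by simp [hp])).trans hT), ?_⟩
  rw [forall_mem_zip]
  exact fun i hi hi' => (key i hi hi' (by omega)).1

theorem termSub_scons {Θ' : List Srt} {Δ' : List Knd} {Γ Γ' : List (Ty S.Base)} {σ : ℕ → Idx}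
    {θ : ℕ → Ty S.Base} {ρ : ℕ → Expr S} {es : List (Expr S)} {τs : List (Ty S.Base)}
    (hl : es.length = τs.length) (h : ∀ p ∈ es.zip τs, HasType Θ' Δ' Γ' p.1 (p.2.subst σ θ))
    (hρ : TermSub Θ' Δ' Γ' σ θ ρ Γ) : TermSub Θ' Δ' Γ' σ θ (scons es ρ) (τs ++ Γ) := by
  intro i τ hi
  rcases lt_or_ge i τs.length with hl' | hl'
  · rw [List.getElem?_append_left hl', List.getElem?_eq_getElem hl'] at hi
    cases hi
    have hi' : i < es.length := hl ▸ hl'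
    rw [scons, List.getElem?_eq_getElem hi']
    exact forall_mem_zip.mp h i hi' hl'
  · rw [List.getElem?_append_right hl'] at hi
    rw [scons, List.getElem?_eq_none (hl ▸ hl'), hl]
    exact hρ _ _ hi

theorem termSub_nil (Θ' : List Srt) (Δ' : List Knd) (Γ' : List (Ty S.Base)) (σ : ℕ → Idx)
    (θ : ℕ → Ty S.Base) (ρ : ℕ → Expr S) : TermSub Θ' Δ' Γ' σ θ ρ [] := by
  intro i τ hi
  simp at hi

theorem HasType.instE {ins : List (Ty S.Base)} {b : Expr S} {args : List (Expr S)}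
    {τ : Ty S.Base} (hb : HasType [] [] ins b τ) (hl : args.length = ins.length)
    (h : ∀ p ∈ args.zip ins, HasType [] [] [] p.1 p.2) : HasType [] [] [] (b.instE args) τ := by
  rw [← List.append_nil ins] at hb
  have := hb.subst (sortSub_var []) (kindSub_var [] [])
    (termSub_scons (es := args) hl (by simpa using h) (termSub_nil [] [] [] .var .var .var))
  rwa [Ty.subst_var] at this

/-- In the instantiating cases each atom has its own derivation, whose body type is only equivalent
to the one in the type of the array. Conversion happens before substituting, and the literal shape
of the array then replaces the index from the typing rule. -/
theorem Red.preservation {δ : S.Op → List (Expr S) → Option (Expr S)}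
    (hδ : ∀ (o : S.Op) (vs : List (Expr S)) (e' : Expr S),
      ArgsOk o vs → δ o vs = some e' → HasType [] [] [] e' (S.opOut o))
    {e e' : Expr S} (hr : Red δ e e') {T : Ty S.Base} (h : HasType [] [] [] e T) :
    HasType [] [] [] e' T := by
  cases hr with
  | lift _ hok hιf hnp hpre _ => exact h.lift hok hιf hnp hpre
  | map _ _ _ hok hιf hfr => exact h.map hok hιf hfr
  | beta _ hl hargs =>
    obtain ⟨out, hb, hout, ht⟩ := h.app_scalar_inv hargs hl fun T hT => by
      obtain ⟨τ, -, hb, hT⟩ := hT.inversion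
      exact ⟨τ, hb, hT⟩
    rw [List.append_nil] at hb
    exact .eqv (hb.instE hl ht) hout
  | @delta o _ _ _ _ hv hl hargs hd =>
    obtain ⟨out, rfl, hout, ht⟩ := h.app_scalar_inv (P := (· = S.opOut o)) hargs hl
      fun T hT => ⟨_, rfl, hT.inversion⟩
    exact .eqv (hδ _ _ _ ⟨hv, hl, ht⟩ hd) hout
  | @tbeta ds fs τs _ _ hfs =>
    obtain ⟨ks, τ, ιf, ι, hf, hl, hk, htag, hT⟩ := h.inversion
    obtain ⟨τ', ha, -, hlf, -, hτ⟩ := hf.inversion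
    obtain ⟨hτ, hιf⟩ := hτ.arr_arr
    have hkind := hf.hasKind_closed.of_arr.1
    have hkb : HasKind [] ks (.arr τ ι) .array := by
      cases hkind with | all h => rwa [List.append_nil] at h
    have hinst : (Ty.arr τ ι).instT τs = .arr (τ.instT τs) ι := by
      simp [Ty.instT, Ty.subst]
    have hki : HasKind [] [] (.arr (τ.instT τs) ι) .array := by
      rw [← hinst]
      exact HasKind.instT (by simpa using hkb) hl hk
    have heq : TEqv [] (.arr (τ.instT τs) (.app [ιf, ι]))
        (.arr (τ.instT τs) (.app [.lit ds, ι])) := by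
      refine .arr_of_val (.refl _) (h.hasKind_closed.eqv hT.symm).of_arr.2
        (hasSort_app.mpr ⟨hasSort_lit _ _, hki.of_arr.2⟩) (by simp [← hιf])
    refine .eqv (.frame (fun e he => ?_) hki (by simpa using hlf) (htag.trans heq))
      (heq.symm.trans hT)
    obtain ⟨f, hf', rfl⟩ := List.mem_map.mp he
    have hfa := HasAtomType.eqv (ha _ (List.mem_map_of_mem hf')) hτ
    obtain ⟨τ₁, -, hb, hτ₁⟩ := hfa.inversion
    obtain ⟨τ₂, hτ₂, hτ₁⟩ := hτ₁.all_inv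
    obtain ⟨rfl, rfl⟩ : ks = f.1 ∧ Ty.arr τ ι = τ₂ := by simpa using hτ₂
    rw [← hinst]
    exact (HasType.eqv hb hτ₁).subst (sortSub_var []) (kindSub_scons hl hk (kindSub_var _ _))
      (termSub_nil _ _ _ _ _ _)
  | @ibeta ds fs ιs _ _ hfs =>
    obtain ⟨γs, τ, ιf, ι, hf, hl, hk, htag, hT⟩ := h.inversion
    obtain ⟨τ', ha, -, hlf, -, hτ⟩ := hf.inversion
    obtain ⟨hτ, hιf⟩ := hτ.arr_arr
    have hkind := hf.hasKind_closed.of_arr.1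
    have hkb : HasKind (γs ++ []) [] (.arr τ ι) .array := by
      cases hkind with | pi h => exact h
    have hki : HasKind [] [] (.arr (τ.instI ιs) (ι.subst (scons ιs .var))) .array :=
      hkb.instI hl hk
    have heq : TEqv [] (.arr (τ.instI ιs) (.app [ιf, ι.subst (scons ιs .var)]))
        (.arr (τ.instI ιs) (.app [.lit ds, ι.subst (scons ιs .var)])) := by
      refine .arr_of_val (.refl _) (h.hasKind_closed.eqv hT.symm).of_arr.2
        (hasSort_app.mpr ⟨hasSort_lit _ _, hki.of_arr.2⟩) (by simp [← hιf])
    refine .eqv (.frame (fun e he => ?_) hki (by simpa using hlf) (htag.trans heq))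
      (heq.symm.trans hT)
    obtain ⟨f, hf', rfl⟩ := List.mem_map.mp he
    have hfa := HasAtomType.eqv (ha _ (List.mem_map_of_mem hf')) hτ
    obtain ⟨τ₁, -, hb, hτ₁⟩ := hfa.inversion
    obtain ⟨τ₂, hτ₂, hτ₁⟩ := hτ₁.pi_inv
    obtain ⟨rfl, rfl⟩ : γs = f.1 ∧ Ty.arr τ ι = τ₂ := by simpa using hτ₂
    exact (HasType.eqv hb hτ₁).subst (sortSub_scons hl hk (sortSub_var _)) (kindSub_var _ _)
      (termSub_nil _ _ _ _ _ _)
  | @unbox ds bs n b _ _ hbs =>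
    obtain ⟨γs, τ, τb, ιs, ιb, he, rfl, hb, hkb, htag, hT⟩ := h.inversion
    obtain ⟨τ', ha, -, hlf, -, hτ⟩ := he.inversion
    obtain ⟨hτ, hιs⟩ := hτ.arr_arr
    have heq : TEqv [] (.arr τb (.app [ιs, ιb])) (.arr τb (.app [.lit ds, ιb])) := by
      refine .arr_of_val (.refl _) (h.hasKind_closed.eqv hT.symm).of_arr.2
        (hasSort_app.mpr ⟨hasSort_lit _ _, hkb.of_arr.2⟩) (by simp [← hιs])
    refine .eqv (.frame (fun e he => ?_) hkb (by simpa using hlf) (htag.trans heq))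
      (heq.symm.trans hT)
    obtain ⟨c, hc, rfl⟩ := List.mem_map.mp he
    have hca := HasAtomType.eqv (ha _ (List.mem_map_of_mem hc)) hτ
    obtain ⟨γs', τ₁, -, -, hl, hs, hc', hτ₁⟩ := hca.inversion
    obtain ⟨τ₂, hτ₂, hτ₁⟩ := hτ₁.sigma_inv
    obtain ⟨rfl, rfl⟩ : γs = γs' ∧ τ = τ₂ := by simpa using hτ₂
    have hσ := sortSub_scons hl hs (sortSub_var _)
    -- The content is typed by the box's own annotation, converted here to the instantiated type of
    -- the whole array. The result type was shifted past the hidden indices, so instantiating them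
    -- gives it back unchanged.
    have := hb.subst hσ (kindSub_var _ _) (termSub_scons (es := [c.2.1]) (τs := [τ]) rfl
      (by simpa using .eqv hc' (hτ₁.subst hσ .var)) (termSub_nil [] [] [] _ _ .var))
    rwa [Ty.shiftI_subst_scons _ _ hl, Ty.subst_var] at this
  | @collapse n n' cells τ ι hv hι =>
    obtain ⟨τ', ι', hc, hk, hl, htag, hT⟩ := h.inversion
    obtain ⟨hτ, hιv⟩ := htag.arr_arr
    rw [(idxEqv_nil_iff.mp hι).2.2] at hιv
    -- The cell shape is obtained by cancelling `n` in the tag, which works even if there are no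
    -- cells.
    have hn' : ι'.val = n' := by simpa using hιv.symm
    have hcell : ∀ c ∈ cells, (∀ a ∈ c.1, HasAtomType [] [] [] a τ') ∧ c.1.length = n'.prod := by
      intro c hc'
      obtain ⟨τ₁, ha, -, hl, -, hτ₁⟩ := (hc _ (List.mem_map_of_mem hc')).inversion
      exact ⟨fun a ha' => .eqv (ha a ha') hτ₁.arr_arr.1, hl⟩
    have heq : TEqv [] (.arr τ' (.app [.lit n, ι'])) (.arr τ' (.lit (n ++ n'))) :=
      .arr_of_val (.refl _) (h.hasKind_closed.eqv hT.symm).of_arr.2 (hasSort_lit _ _)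
        (by simp [hn'])
    refine .eqv (.array (fun a ha => ?_) hk.of_arr.1 ?_ (htag.trans heq)) (heq.symm.trans hT)
    · obtain ⟨l, hl', ha⟩ := List.mem_flatten.mp ha
      obtain ⟨c, hc', rfl⟩ := List.mem_map.mp hl'
      exact (hcell c hc').1 a ha
    · rw [length_flatten_of_forall (n := n'.prod), List.prod_append, ← hl]
      · simp
      · intro l hl'
        obtain ⟨c, hc', rfl⟩ := List.mem_map.mp hl'
        exact (hcell c hc').2

-- Replacement in evaluation contexts

theorem getElem?_append_cons {α : Type*} {pre post : List α} {x x' y : α} {i : ℕ}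
    (h : (pre ++ x :: post)[i]? = some y) :
    (i = pre.length ∧ x = y) ∨ (pre ++ x' :: post)[i]? = some y := by
  rcases lt_trichotomy i pre.length with hi | rfl | hi
  · rw [List.getElem?_append_left hi] at h ⊢
    exact .inr h
  · simp at h
    exact .inl ⟨rfl, h⟩
  · obtain ⟨j, rfl⟩ := Nat.exists_eq_add_of_lt hi
    rw [List.getElem?_append_right (by omega)] at h ⊢
    simp only [add_assoc, Nat.add_sub_cancel_left, List.getElem?_cons_succ] at h ⊢
    exact .inr h

/-- No evaluation context enters a binder, so the hole is typed in the empty environments. Its type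
is found only by inversion, which is why the hypothesis ranges over all types. -/
theorem Ctx.hasType_fill {e e' : Expr S}
    (he : ∀ T, HasType [] [] [] e T → HasType [] [] [] e' T) (E : Ctx S) {T : Ty S.Base}
    (h : HasType [] [] [] (E.fill e) T) : HasType [] [] [] (E.fill e') T := by
  induction E generalizing T with
  | hole => exact he T h
  | box ds pre hpre ιs E τ post tag ih =>
    obtain ⟨τ', ha, hk, hl, htag, hT⟩ := h.inversion
    refine .eqv (.array (fun a ha' => ?_) hk (by simpa using hl) htag) hT
    rcases List.mem_append.mp ha' with h | h
    · exact ha a (List.mem_append_left _ h)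
    rcases List.mem_cons.mp h with rfl | h
    · obtain ⟨γs, τ₁, rfl, h₁, h₂, h₃, h₄, h₅⟩ := (ha (.box ιs (E.fill e) τ) (by simp)).inversion
      exact .eqv (.box h₁ h₂ h₃ (ih h₄)) h₅
    · exact ha a (by simp [h])
  | frame ds pre hpre E post tag ih =>
    obtain ⟨τ, ι, hc, hk, hl, htag, hT⟩ := h.inversion
    refine .eqv (.frame (fun a ha' => ?_) hk (by simpa using hl) htag) hT
    rcases List.mem_append.mp ha' with h | h
    · exact hc a (List.mem_append_left _ h)
    rcases List.mem_cons.mp h with rfl | h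
    · exact ih (hc _ (by simp))
    · exact hc a (by simp [h])
  | appFun E args tag ih =>
    obtain ⟨cells, frames, τo, ιf, ιo, ιp, hf, h₁, h₂, h₃, h₄, h₅, h₆⟩ := h.inversion
    exact .eqv (.app (ih hf) h₁ h₂ h₃ h₄ h₅) h₆
  | appArg f hf pre hpre E post tag ih =>
    obtain ⟨cells, frames, τo, ιf, ιo, ιp, hf, h₁, h₂, h₃, h₄, h₅, h₆⟩ := h.inversion
    refine .eqv (.app hf (by simpa using h₁) h₂ (fun i a c ι ha hc hι => ?_) h₄ h₅) h₆
    rcases getElem?_append_cons (x' := E.fill e) ha with ⟨rfl, rfl⟩ | h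
    · exact ih (h₃ _ _ c ι (by simp) hc hι)
    · exact h₃ i a c ι h hc hι
  | tapp E τs tag ih =>
    obtain ⟨ks, τ, ιf, ι, hf, h₁, h₂, h₃, h₄⟩ := h.inversion
    exact .eqv (.tapp (ih hf) h₁ h₂ h₃) h₄
  | iapp E ιs tag ih =>
    obtain ⟨ks, τ, ιf, ι, hf, h₁, h₂, h₃, h₄⟩ := h.inversion
    exact .eqv (.iapp (ih hf) h₁ h₂ h₃) h₄
  | unbox n E b tag ih =>
    obtain ⟨γs, τ, τb, ιs, ιb, hf, h₁, h₂, h₃, h₄, h₅⟩ := h.inversion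
    exact .eqv (.unbox (ih hf) h₁ h₂ h₃ h₄) h₅

theorem Step.preservation {δ : S.Op → List (Expr S) → Option (Expr S)}
    (hδ : ∀ (o : S.Op) (vs : List (Expr S)) (e' : Expr S),
      ArgsOk o vs → δ o vs = some e' → HasType [] [] [] e' (S.opOut o))
    {e e' : Expr S} (hr : Step δ e e') {T : Ty S.Base} (h : HasType [] [] [] e T) :
    HasType [] [] [] e' T := by
  obtain ⟨E, hr⟩ := hr
  exact E.hasType_fill (fun _ => hr.preservation hδ) h

/-! ## Progress -/

/-- The expression can make a step, or it is stuck at an operator that is undefined at its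
arguments. -/
def CanProceed (δ : S.Op → List (Expr S) → Option (Expr S)) (e : Expr S) : Prop :=
  (∃ e', Step δ e e') ∨
    ∃ (E : Ctx S) (o : S.Op) (vs : List (Expr S)) (τf τr : Ty S.Base),
      ArgsOk o vs ∧ δ o vs = none ∧ e = E.fill (.app (.array [] [.op o] τf) vs τr)

section Progress

variable {δ : S.Op → List (Expr S) → Option (Expr S)}

theorem Red.canProceed {e e' : Expr S} (h : Red δ e e') : CanProceed δ e :=
  .inl ⟨e', .mk .hole h⟩

/-- Serves all congruence cases of progress: `F` adds one layer to a context and `G` is the same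
layer on terms. Both a step and a stuck operator pass through the layer. -/
theorem CanProceed.ctx {e : Expr S} (h : CanProceed δ e) (F : Ctx S → Ctx S)
    (G : Expr S → Expr S) (hF : ∀ (E : Ctx S) (x : Expr S), (F E).fill x = G (E.fill x)) :
    CanProceed δ (G e) := by
  rcases h with ⟨_, E, h⟩ | ⟨E, o, vs, τf, τr, h₁, h₂, rfl⟩
  · rw [← hF]
    exact .inl ⟨_, .mk (F E) h⟩
  · exact .inr ⟨F E, o, vs, τf, τr, h₁, h₂, (hF E _).symm⟩

/-- Left-to-right evaluation: the leftmost component that is not known to be a value is preceded by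
values only, as the contexts demand. -/
theorem forall_or_exists_first {α : Type*} {P Q : α → Prop} {l : List α}
    (h : ∀ x ∈ l, P x ∨ Q x) :
    (∀ x ∈ l, P x) ∨ ∃ pre x post, l = pre ++ x :: post ∧ (∀ y ∈ pre, P y) ∧ Q x := by
  induction l with
  | nil => exact .inl (by simp)
  | cons a l ih =>
    rcases h a (by simp) with ha | ha
    · rcases ih fun x hx => h x (by simp [hx]) with ih | ⟨pre, x, post, rfl, hp, hx⟩
      · exact .inl (by simpa using ⟨ha, ih⟩)
      · exact .inr ⟨a :: pre, x, post, rfl, by simpa using ⟨ha, hp⟩, hx⟩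
    · exact .inr ⟨[], a, l, rfl, by simp, ha⟩

theorem exists_list_of_forall {α : Type*} (n : ℕ) {P : ℕ → α → Prop}
    (h : ∀ i < n, ∃ a, P i a) :
    ∃ l : List α, l.length = n ∧ ∀ (i : ℕ) (hi : i < l.length), P i l[i] := by
  choose f hf using fun i : Fin n => h i i.2
  exact ⟨List.ofFn f, by simp, fun i hi => by simpa using hf ⟨i, by simpa using hi⟩⟩

theorem eq_map_of_getElem? {α β : Type*} {l : List β} {l' : List α} {g : α → β}
    (hl : l.length = l'.length) (h : ∀ i (hi : i < l'.length), l[i]? = some (g l'[i])) :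
    l = l'.map g := by
  refine List.ext_getElem (by simpa using hl) fun i hi hi' => ?_
  have := h i (hl ▸ hi)
  rw [List.getElem?_eq_getElem hi] at this
  simpa using this

theorem IsVal.exists_array {v : Expr S} (h : IsVal v) :
    ∃ ds as τ, v = .array ds as τ ∧ ∀ a ∈ as, IsAtomVal a := by
  cases h with
  | array h => exact ⟨_, _, _, rfl, h⟩

/-- The data of arguments that are values. -/
theorem exists_appArg {v : Expr S} {τ τ' : Ty S.Base} {ι ι' : Idx} (hv : IsVal v)
    (h : HasType [] [] [] v (.arr τ (.app [ι', ι]))) (hτ : TEqv [] τ' (.arr τ ι)) :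
    ∃ a : AppArg S, a.expr = v ∧ a.inTy = τ' ∧ a.Ok ∧ a.frame = ι'.val := by
  obtain ⟨ds, as, tag, rfl, -⟩ := hv.exists_array
  obtain ⟨τ₁, ι₁, rfl, -⟩ := hτ.symm.arr_inv
  have hτ' := hτ
  obtain ⟨hτ, hι⟩ := hτ.arr_arr
  obtain ⟨τ₂, ha, -, -, htag, ht⟩ := h.inversion
  have hs := h.hasKind_closed.of_arr.2
  -- Typing splits the dimensions of the literal into the frame and the cell shape required by the
  -- redex.
  have hds : ds = ι'.val ++ ι.val := by simpa using ht.arr_arr.2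
  subst hds
  have hs₁ : HasSort [] ι₁ .shape :=
    ((HasKind.arr h.hasKind_closed.of_arr.1 (hasSort_app.mp hs).2).eqv hτ'.symm).of_arr.2
  exact ⟨⟨τ₁, ι₁, ι.val, ι'.val, as, tag⟩, rfl, rfl,
    ⟨idxEqv_nil_iff.mpr ⟨hs₁, hasSort_lit _ _, by simp [hι]⟩,
      h.array_tag.trans (.arr_of_val hτ.symm hs (hasSort_lit _ _) (by simp)), hv⟩, rfl⟩

theorem AppArg.Ok.tag_eqv {a : AppArg S} (h : a.Ok) : TEqv [] a.tag (.arr a.cellTy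
    (.app [.lit a.frame, a.cellIdx])) :=
  h.2.1.trans (.arr_of_val (.refl _) (hasSort_lit _ _)
    (hasSort_app.mpr ⟨hasSort_lit _ _, h.1.1⟩) (by simp [(idxEqv_nil_iff.mp h.1).2.2]))

/-- The side conditions of lift, map and scalar application exhaust the possibilities for frames
with a common maximum. In the scalar case the function type excludes every atom other than
abstractions and operators. -/
theorem canProceed_app {f : Expr S} {es : List (Expr S)} {tag T : Ty S.Base} (hf : IsVal f)
    (hes : ∀ e ∈ es, IsVal e) (h : HasType [] [] [] (.app f es tag) T) :
    CanProceed δ (.app f es tag) := by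
  obtain ⟨cells, frames, τo, ιf, ιo, ιp, hft, hlen, hlen', hargs, hmax, -, -⟩ := h.inversion
  obtain ⟨nf, fs, tagf, rfl, hfs⟩ := hf.exists_array
  have hkf := hft.hasKind_closed
  obtain ⟨τ, ha, hk, hl, htag, ht⟩ := hft.inversion
  have htagf := hft.array_tag
  obtain ⟨τ₁, ι₁, rfl, -⟩ := htagf.symm.arr_inv
  obtain ⟨ins, out, rfl, -⟩ := htagf.arr_arr.1.symm.fn_inv
  obtain ⟨hfn, hι₁⟩ := htagf.arr_arr
  obtain ⟨hins, -⟩ := hfn.fn_fn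
  have hkf' := (hkf.eqv htagf.symm).of_arr
  have hιf : ιf.val = nf := by simpa using ht.arr_arr.2.symm
  have hι₁' : IdxEqv [] ι₁ (.lit nf) :=
    idxEqv_nil_iff.mpr ⟨hkf'.2, hasSort_lit _ _, by simp [hι₁, hιf]⟩
  have hil : ins.length = cells.length := by simpa using hins.length_eq
  -- Lift and map redexes present the arguments and the input types in the function's tag as images
  -- of one list of `AppArg`; that list is assembled position by position.
  obtain ⟨args, hal, hA⟩ := exists_list_of_forall es.length
    (P := fun i (a : AppArg S) => es[i]? = some a.expr ∧ ins[i]? = some a.inTy ∧ a.Ok ∧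
      (frames.map Idx.val)[i]? = some a.frame) (by
    intro i hi
    have h₁ := hargs i _ _ _ (List.getElem?_eq_getElem hi)
      (List.getElem?_eq_getElem (by omega)) (List.getElem?_eq_getElem (by omega))
    have h₂ := hins.get (i := i) (by omega) (by simp; omega)
    simp only [List.get_eq_getElem, List.getElem_map] at h₂
    obtain ⟨a, h₃, h₄, h₅, h₆⟩ := exists_appArg (hes _ (List.getElem_mem _)) h₁ h₂
    refine ⟨a, ?_, ?_, h₅, ?_⟩
    · rw [h₃, List.getElem?_eq_getElem hi]
    · rw [h₄, List.getElem?_eq_getElem]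
    · rw [h₆, List.getElem?_map, List.getElem?_eq_getElem (by omega)]; rfl)
  obtain rfl := eq_map_of_getElem? hal.symm fun i hi => (hA i hi).1
  obtain rfl := eq_map_of_getElem? (l := ins) (by omega) fun i hi => (hA i hi).2.1
  have hfr : frames.map Idx.val = args.map AppArg.frame :=
    eq_map_of_getElem? (by rw [List.length_map]; omega) fun i hi => (hA i hi).2.2.2
  have hok : ∀ a ∈ args, a.Ok := by
    intro a ha
    obtain ⟨i, hi, rfl⟩ := List.mem_iff_getElem.mp ha
    exact (hA i hi).2.2.1
  have hmem : ιp.val ∈ nf :: args.map AppArg.frame := by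
    rw [← hfr, ← hιf, ← List.map_cons (f := Idx.val)]
    exact List.mem_map_of_mem hmax.1
  have hpre : ∀ n ∈ nf :: args.map AppArg.frame, n <+: ιp.val := by
    rw [← hfr, ← hιf, ← List.map_cons (f := Idx.val)]
    intro n hn
    obtain ⟨ι, hι, rfl⟩ := List.mem_map.mp hn
    exact prefix_nil (hmax.2 ι hι)
  by_cases hne : ∃ n ∈ nf :: args.map AppArg.frame, n ≠ ιp.val
  · exact (Red.lift hfs hok hι₁' hmem hpre hne).canProceed
  push Not at hne
  have hnf := hne nf (by simp)
  have hfr' : ∀ a ∈ args, a.frame = nf := fun a ha =>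
    (hne _ (List.mem_cons_of_mem _ (List.mem_map_of_mem ha))).trans hnf.symm
  by_cases hnil : nf ≠ []
  · exact (Red.map hnil hl hfs hok hι₁' hfr').canProceed
  obtain rfl : nf = [] := by simpa using hnil
  obtain ⟨a, rfl⟩ := List.length_eq_one_iff.mp (by simpa using hl)
  have hat := (HasAtomType.eqv (ha a (by simp)) htag.symm.arr_arr.1).inversion
  -- The input types of the abstraction or operator are merely equivalent to those in the function's
  -- tag, hence the quantification. Empty frames make the tags of the arguments equivalent to
  -- either.
  have hscalar : ∀ ins : List (Ty S.Base), List.Forall₂ (TEqv []) ins (args.map AppArg.inTy) →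
      (args.map AppArg.expr).length = ins.length ∧
      ∀ p ∈ (args.map AppArg.expr).zip ins, ∃ ds as τ, p.1 = .array ds as τ ∧ TEqv [] τ p.2 := by
    intro ins hins
    refine ⟨by simpa using hins.length_eq.symm, ?_⟩
    rw [forall_mem_zip]
    intro i hi hi'
    simp only [List.length_map] at hi
    have hok' := hok args[i] (List.getElem_mem _)
    have h₂ := hins.get hi' (by simpa using hi)
    simp only [List.get_eq_getElem, List.getElem_map] at h₂ ⊢
    refine ⟨_, _, _, rfl, hok'.tag_eqv.trans (.trans ?_ h₂.symm)⟩
    exact .arr_of_val (.refl _) (hasSort_app.mpr ⟨hasSort_lit _ _, hok'.1.1⟩) hok'.1.1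
      (by simp [hfr' args[i] (List.getElem_mem _)])
  cases a with
  | const c => cases hat
  | op o =>
    obtain ⟨h₁, h₂⟩ := hscalar _ hat.fn_fn.1
    cases hd : δ o (args.map AppArg.expr) with
    | some e => exact (Red.delta hes h₁ h₂ hd).canProceed
    | none =>
      obtain ⟨-, -, -, ht⟩ := h.app_scalar_inv (P := (· = S.opOut o)) h₂ h₁
        fun T hT => ⟨_, rfl, hT.inversion⟩
      exact .inr ⟨.hole, o, _, _, _, ⟨hes, h₁, ht⟩, hd, rfl⟩
  | lam ins b =>
    obtain ⟨_, -, -, hat⟩ := hat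
    obtain ⟨h₁, h₂⟩ := hscalar _ hat.fn_fn.1
    exact (Red.beta hes h₁ h₂).canProceed
  | tlam | ilam =>
    obtain ⟨_, -, -, hat⟩ := hat
    cases hat
  | box =>
    obtain ⟨_, _, -, -, -, -, -, hat⟩ := hat
    cases hat

theorem exists_map_eq_of_forall {α β : Type*} {l : List α} {f : β → α} (h : ∀ x ∈ l, ∃ y, f y = x) :
    ∃ l' : List β, l = l'.map f := by
  induction l with
  | nil => exact ⟨[], rfl⟩
  | cons a l ih =>
    obtain ⟨b, rfl⟩ := h a (by simp)
    obtain ⟨l', rfl⟩ := ih fun x hx => h x (by simp [hx])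
    exact ⟨b :: l', rfl⟩

/-- A frame of values always collapses: the common cell type forces all literals to have shape
`ι.val`, and with no cells this shape is still available from the typing. -/
theorem canProceed_frame {ds : List ℕ} {es : List (Expr S)} {tag T : Ty S.Base}
    (hes : ∀ e ∈ es, IsVal e) (h : HasType [] [] [] (.frame ds es tag) T) :
    CanProceed δ (.frame ds es tag) := by
  obtain ⟨τ, ι, hc, hk, hl, htag, -⟩ := h.inversion
  obtain ⟨τ₁, ι₁, rfl, -⟩ := htag.symm.arr_inv
  have hι₁ : HasSort [] ι₁ .shape :=
    ((HasKind.arr hk.of_arr.1 (hasSort_app.mpr ⟨hasSort_lit _ _, hk.of_arr.2⟩)).eqv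
      htag.symm).of_arr.2
  obtain ⟨cells, rfl⟩ : ∃ cells : List (List (Atom S) × Ty S.Base),
      es = cells.map fun c => .array ι.val c.1 c.2 := by
    refine exists_map_eq_of_forall fun e he => ?_
    obtain ⟨ds', as, τ', rfl, -⟩ := (hes e he).exists_array
    obtain ⟨τ₂, -, -, -, -, hτ₂⟩ := (hc _ he).inversion
    obtain rfl : ds' = ι.val := by simpa using hτ₂.arr_arr.2
    exact ⟨(as, τ'), rfl⟩
  refine (Red.collapse (n' := ι.val) (fun c hc a ha => ?_)
    (idxEqv_nil_iff.mpr ⟨hι₁, hasSort_lit _ _, ?_⟩)).canProceed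
  · obtain ⟨_, _, _, he, h⟩ := (hes _ (List.mem_map_of_mem hc)).exists_array
    cases he
    exact h a ha
  · simp [htag.arr_arr.2]

/-- Canonical forms: equivalence preserves the outermost constructor and the binder list, so every
atom is a type abstraction over `ks`. That its body is a value is part of the typing rule. -/
theorem canProceed_tapp {f : Expr S} {τs : List (Ty S.Base)} {tag T : Ty S.Base} (hf : IsVal f)
    (h : HasType [] [] [] (.tapp f τs tag) T) : CanProceed δ (.tapp f τs tag) := by
  obtain ⟨ks, τ, ιf, ι, hft, hl, -⟩ := h.inversion
  obtain ⟨ds, as, tagf, rfl, has⟩ := hf.exists_array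
  obtain ⟨τ₁, ha, -, -, -, hτ⟩ := hft.inversion
  have key : ∀ a ∈ as, ∃ f : List Knd × Expr S, (IsVal f.2 ∧ f.1.length = τs.length) ∧
      Atom.tlam f.1 f.2 = a := by
    intro a ha'
    have hat := (HasAtomType.eqv (ha a ha') hτ.arr_arr.1).inversion
    cases a with
    | const | op => cases hat
    | lam | ilam => obtain ⟨_, -, -, hat⟩ := hat; cases hat
    | box => obtain ⟨_, _, -, -, -, -, -, hat⟩ := hat; cases hat
    | tlam ks' b =>
      obtain ⟨_, hb, -, hat⟩ := hat
      obtain ⟨_, he, -⟩ := hat.all_inv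
      cases he
      exact ⟨(ks, b), ⟨hb, hl.symm⟩, rfl⟩
  obtain ⟨fs, rfl⟩ := exists_map_eq_of_forall (f := fun f : List Knd × Expr S => Atom.tlam f.1 f.2)
    fun a ha => (key a ha).imp fun _ h => h.2
  refine (Red.tbeta fun f hf => ?_).canProceed
  obtain ⟨f', hf', he⟩ := key _ (List.mem_map_of_mem hf)
  cases f; cases f'; cases he
  exact hf'

theorem canProceed_iapp {f : Expr S} {ιs : List Idx} {tag T : Ty S.Base} (hf : IsVal f)
    (h : HasType [] [] [] (.iapp f ιs tag) T) : CanProceed δ (.iapp f ιs tag) := by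
  obtain ⟨γs, τ, ιf, ι, hft, hl, -⟩ := h.inversion
  obtain ⟨ds, as, tagf, rfl, has⟩ := hf.exists_array
  obtain ⟨τ₁, ha, -, -, -, hτ⟩ := hft.inversion
  have key : ∀ a ∈ as, ∃ f : List Srt × Expr S, (IsVal f.2 ∧ f.1.length = ιs.length) ∧
      Atom.ilam f.1 f.2 = a := by
    intro a ha'
    have hat := (HasAtomType.eqv (ha a ha') hτ.arr_arr.1).inversion
    cases a with
    | const | op => cases hat
    | lam | tlam => obtain ⟨_, -, -, hat⟩ := hat; cases hat
    | box => obtain ⟨_, _, -, -, -, -, -, hat⟩ := hat; cases hat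
    | ilam ks' b =>
      obtain ⟨_, hb, -, hat⟩ := hat
      obtain ⟨_, he, -⟩ := hat.pi_inv
      cases he
      exact ⟨(γs, b), ⟨hb, hl.symm⟩, rfl⟩
  obtain ⟨fs, rfl⟩ := exists_map_eq_of_forall (f := fun f : List Srt × Expr S => Atom.ilam f.1 f.2)
    fun a ha => (key a ha).imp fun _ h => h.2
  refine (Red.ibeta fun f hf => ?_).canProceed
  obtain ⟨f', hf', he⟩ := key _ (List.mem_map_of_mem hf)
  cases f; cases f'; cases he
  exact hf'

/-- In contrast to abstractions, typing does not make the content of a box a value; this comes from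
the array being a value. -/
theorem canProceed_unbox {n : ℕ} {e b : Expr S} {tag T : Ty S.Base} (hv : IsVal e)
    (h : HasType [] [] [] (.unbox n e b tag) T) : CanProceed δ (.unbox n e b tag) := by
  obtain ⟨γs, τ, τb, ιs, ιb, het, rfl, -⟩ := h.inversion
  obtain ⟨ds, as, tagb, rfl, has⟩ := hv.exists_array
  obtain ⟨τ₁, ha, -, -, -, hτ⟩ := het.inversion
  have key : ∀ a ∈ as, ∃ c : List Idx × Expr S × Ty S.Base,
      (IsVal c.2.1 ∧ c.1.length = γs.length) ∧ Atom.box c.1 c.2.1 c.2.2 = a := by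
    intro a ha'
    have hat := (HasAtomType.eqv (ha a ha') hτ.arr_arr.1).inversion
    have hva := has a ha'
    cases a with
    | const | op => cases hat
    | lam | tlam | ilam => obtain ⟨_, -, -, hat⟩ := hat; cases hat
    | box ιs' e τ' =>
      obtain ⟨γs', _, -, -, hl, -, -, hat⟩ := hat
      obtain ⟨_, he, -⟩ := hat.sigma_inv
      cases he
      cases hva with
      | box hva => exact ⟨(ιs', e, τ'), ⟨hva, hl⟩, rfl⟩
  obtain ⟨bs, rfl⟩ := exists_map_eq_of_forall
    (f := fun c : List Idx × Expr S × Ty S.Base => Atom.box c.1 c.2.1 c.2.2)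
    fun a ha => (key a ha).imp fun _ h => h.2
  refine (Red.unbox fun f hf => ?_).canProceed
  obtain ⟨f', hf', he⟩ := key _ (List.mem_map_of_mem hf)
  obtain ⟨_, _, _⟩ := f
  obtain ⟨_, _, _⟩ := f'
  cases he
  exact hf'

-- Emptiness of the environments is expressed by equations so that the recursion can follow the
-- derivation. It never leaves the empty environments: bodies of `λ` and `unbox` are not evaluated,
-- and bodies of type and index abstractions are values by typing.
mutual
theorem HasType.progress {Θ : List Srt} {Δ : List Knd} {Γ : List (Ty S.Base)} {e : Expr S}
    {T : Ty S.Base} (h : HasType Θ Δ Γ e T) (hΘ : Θ = []) (hΔ : Δ = []) (hΓ : Γ = []) :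
    IsVal e ∨ CanProceed δ e := by
  match h with
  | .eqv h _ => exact h.progress hΘ hΔ hΓ
  | .var h => simp [hΓ] at h
  | @HasType.array _ _ _ _ ds as τ tag h₁ h₂ h₃ h₄ =>
    rcases forall_or_exists_first fun a ha => (h₁ a ha).progress hΘ hΔ hΓ with
      h | ⟨pre, a, post, rfl, hp, ιs, e, τ', rfl, he⟩
    · exact .inl (.array h)
    · exact .inr (he.ctx (fun E => .box ds pre hp ιs E τ' post tag)
        (fun e => .array ds (pre ++ .box ιs e τ' :: post) tag) fun _ _ => rfl)
  | @HasType.frame _ _ _ _ ds es τ tag ι h₁ h₂ h₃ h₄ =>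
    rcases forall_or_exists_first fun e he => (h₁ e he).progress hΘ hΔ hΓ with
      h | ⟨pre, e, post, rfl, hp, he⟩
    · refine .inr (canProceed_frame (T := .arr τ (.app [.lit ds, ι])) h ?_)
      rw [← hΘ, ← hΔ, ← hΓ]
      exact .frame h₁ h₂ h₃ h₄
    · exact .inr (he.ctx (fun E => .frame ds pre hp E post tag)
        (fun e => .frame ds (pre ++ e :: post) tag) fun _ _ => rfl)
  | @HasType.app _ _ _ _ f es cells frames τo tag ιf ιo ιp h₁ h₂ h₃ h₄ h₅ h₆ =>
    right
    rcases h₁.progress hΘ hΔ hΓ with hf | hf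
    · have hargs : ∀ e ∈ es, IsVal e ∨ CanProceed δ e := by
        intro e he
        obtain ⟨i, hi, hi'⟩ := List.mem_iff_getElem.mp he
        exact (h₄ i e cells[i] frames[i] (by rw [List.getElem?_eq_getElem hi, hi'])
          (List.getElem?_eq_getElem _) (List.getElem?_eq_getElem _)).progress hΘ hΔ hΓ
      rcases forall_or_exists_first hargs with h | ⟨pre, e, post, rfl, hp, he⟩
      · refine canProceed_app (T := .arr τo (.app [ιp, ιo])) hf h ?_
        rw [← hΘ, ← hΔ, ← hΓ]
        exact .app h₁ h₂ h₃ h₄ h₅ h₆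
      · exact he.ctx (fun E => .appArg f hf pre hp E post tag)
          (fun e => .app f (pre ++ e :: post) tag) fun _ _ => rfl
    · exact hf.ctx (fun E => .appFun E es tag) (fun e => .app e es tag) fun _ _ => rfl
  | @HasType.tapp _ _ _ _ f ks τs τ tag ιf ι h₁ h₂ h₃ h₄ =>
    right
    rcases h₁.progress hΘ hΔ hΓ with hf | hf
    · refine canProceed_tapp (T := .arr (τ.instT τs) (.app [ιf, ι])) hf ?_
      rw [← hΘ, ← hΔ, ← hΓ]
      exact .tapp h₁ h₂ h₃ h₄
    · exact hf.ctx (fun E => .tapp E τs tag) (fun e => .tapp e τs tag) fun _ _ => rfl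
  | @HasType.iapp _ _ _ _ f γs ιs τ tag ιf ι h₁ h₂ h₃ h₄ =>
    right
    rcases h₁.progress hΘ hΔ hΓ with hf | hf
    · refine canProceed_iapp (T := .arr (τ.instI ιs) (.app [ιf, ι.subst (scons ιs .var)])) hf ?_
      rw [← hΘ, ← hΔ, ← hΓ]
      exact .iapp h₁ h₂ h₃ h₄
    · exact hf.ctx (fun E => .iapp E ιs tag) (fun e => .iapp e ιs tag) fun _ _ => rfl
  | @HasType.unbox _ _ _ _ n e b γs τ τb tag ιs ιb h₁ h₂ h₃ h₄ h₅ =>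
    right
    rcases h₁.progress hΘ hΔ hΓ with hf | hf
    · refine canProceed_unbox (T := .arr τb (.app [ιs, ιb])) hf ?_
      rw [← hΘ, ← hΔ, ← hΓ]
      exact .unbox h₁ h₂ h₃ h₄ h₅
    · exact hf.ctx (fun E => .unbox n E b tag) (fun e => .unbox n e b tag) fun _ _ => rfl
termination_by structural h
theorem HasAtomType.progress {Θ : List Srt} {Δ : List Knd} {Γ : List (Ty S.Base)} {a : Atom S}
    {T : Ty S.Base} (h : HasAtomType Θ Δ Γ a T) (hΘ : Θ = []) (hΔ : Δ = []) (hΓ : Γ = []) :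
    IsAtomVal a ∨ ∃ ιs e τ, a = .box ιs e τ ∧ CanProceed δ e := by
  match h with
  | .eqv h _ => exact h.progress hΘ hΔ hΓ
  | .const c => exact .inl (.const c)
  | .op o => exact .inl (.op o)
  | .lam _ _ => exact .inl (.lam _ _)
  | .tlam h _ => exact .inl (.tlam h)
  | .ilam h _ => exact .inl (.ilam h)
  | .box _ _ _ h =>
    rcases h.progress hΘ hΔ hΓ with h | h
    · exact .inl (.box h)
    · exact .inr ⟨_, _, _, rfl, h⟩
termination_by structural h
end

end Progress

/-! ## Type soundness -/

/-- Dependent choice. The sequence is built among the reducts of `e`, so that the hypothesis applies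
again at each stage. -/
theorem diverges_of_forall {δ : S.Op → List (Expr S) → Option (Expr S)} {e : Expr S}
    (h : ∀ e', Relation.ReflTransGen (Step δ) e e' → ∃ e'', Step δ e' e'') : Diverges δ e := by
  choose g hg using fun x : {e' // Relation.ReflTransGen (Step δ) e e'} => h x.1 x.2
  let f : ℕ → {e' // Relation.ReflTransGen (Step δ) e e'} :=
    fun n => n.rec ⟨e, .refl⟩ fun _ x => ⟨g x, x.2.tail (hg x)⟩
  exact ⟨fun n => (f n).1, rfl, fun n => hg (f n)⟩

end Remora

theorem mainTheorem1 (S : Remora.Signature.{u})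
    (δ : S.Op → List (Remora.Expr S) → Option (Remora.Expr S))
    (hδ : ∀ (o : S.Op) (vs : List (Remora.Expr S)) (e' : Remora.Expr S),
      Remora.ArgsOk o vs → δ o vs = some e' → Remora.HasType [] [] [] e' (S.opOut o))
    (e : Remora.Expr S) (τ : Remora.Ty S.Base) (he : Remora.HasType [] [] [] e τ) :
    Remora.Diverges δ e ∨
    (∃ v : Remora.Expr S, Remora.IsVal v ∧ Relation.ReflTransGen (Remora.Step δ) e v ∧
      Remora.HasType [] [] [] v τ) ∨
    (∃ (E : Remora.Ctx S) (o : S.Op) (vs : List (Remora.Expr S)) (τf τr : Remora.Ty S.Base),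
      Remora.ArgsOk o vs ∧ δ o vs = none ∧
      Relation.ReflTransGen (Remora.Step δ) e
        (E.fill (.app (.array [] [.op o] τf) vs τr))) := by
  -- Classical dichotomy: either no reduct is irreducible, or an irreducible one exists, to which
  -- preservation and progress apply.
  by_cases h : ∀ e', Relation.ReflTransGen (Remora.Step δ) e e' → ∃ e'', Remora.Step δ e' e''
  · exact .inl (Remora.diverges_of_forall h)
  push Not at h
  obtain ⟨e', hsteps, hnf⟩ := h
  have ht : Remora.HasType [] [] [] e' τ := by
    clear hnf
    induction hsteps with
    | refl => exact he
    | tail _ hstep ih => exact hstep.preservation hδ ih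
  rcases ht.progress (δ := δ) rfl rfl rfl with hv | ⟨e'', hs⟩ | ⟨E, o, vs, τf, τr, h₁, h₂, rfl⟩
  · exact .inr (.inl ⟨e', hv, hsteps, ht⟩)
  · exact absurd hs (hnf e'')
  · exact .inr (.inr ⟨E, o, vs, τf, τr, h₁, h₂, hsteps⟩)
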